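/- **Lemma 5.3 (uniform strong law for Fourier–RQMC estimators).** *Setting.* Let $\mathbf X$ be an $\mathbb R^d$-valued random vector, let $\mathbf p=(p_1<\dots<p_k)$ be a selection of $k$ coordinates in $\{1,\dots,d\}$, and write $\mathbf X_{k,p}=(X_{p_1},\dots,X_{p_k})$. Let $\ell_{k,p}:\mathbb R^k\to\mathbb R$ be the corresponding loss component, fix $\nu\in\{0,1,2\}$, and let $\ell_{k,p}^{(0)}=\ell_{k,p}$, $\ell_{k,p}^{(1)}=\nabla\ell_{k,p}$, $\ell_{k,p}^{(2)}=\nabla^2\ell_{k,p}$ (pointwise derivatives, taken to be $0$ where they do not exist). For $\mathbf y\in\mathbb C^k$ put $\Phi_{\mathbf X_{k,p}}(\mathbf y)=\mathbb E[e^{\mathrm i\langle \mathbf y,\mathbf X_{k,p}\rangle}]$ and, entry by entry, $\hat\ell^{(\nu)}_{k,p}(\mathbf y)=\int_{\mathbb R^k}e^{-\mathrm i\langle \mathbf y,\mathbf x\rangle}\ell^{(\nu)}_{k,p}(\mathbf x)\,d\mathbf x$, where $\langle\cdot,\cdot\rangle$ is bilinear. Let $\mathbf K\in\mathbb R^k$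 be an admissible damping vector: $\mathbb E[e^{-\langle\mathbf K,\mathbf X_{k,p}\rangle}]<\infty$, $e^{\langle \mathbf K,\cdot\rangle}\ell^{(\nu)}_{k,p}\in L^1(\mathbb R^k)$, and $\Phi_{\mathbf X_{k,p}}(\cdot+\mathrm i\mathbf K)\,\hat\ell^{(\nu)}_{k,p}(\cdot+\mathrm i\mathbf K)\in L^1(\mathbb R^k)$. Define $$h(\mathbf u;\mathbf m)=(2\pi)^{-k}e^{\langle \mathbf K-\mathrm i\mathbf u,\mathbf m\rangle}\,\Phi_{\mathbf X_{k,p}}(\mathbf u+\mathrm i\mathbf K)\,\hat\ell^{(\nu)}_{k,p}(\mathbf u+\mathrm i\mathbf K),\qquad \hat g^{(\nu),\mathrm{Fou}}_{k,p}(\mathbf m)=\Re\int_{\mathbb R^k}h(\mathbf u;\mathbf m)\,d\mathbf u,\qquad \mathbf u,\mathbf m\in\mathbb R^k .$$ *Domain transformation.* Let $T:[0,1]^s\to\mathbb R^k$ with weight $J$ be of one of the following two kinds. (a) $s=k$, $T=G^{-1}$ is differentiable and injective on a measurable subset of full measure of the open cube, the image of this subset has null complement in $\mathbb R^k$, and $J(\mathbf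 v)=|\det DT(\mathbf v)|$. (b) $T$ is measurable and transports the uniform law on $[0,1]^s$ to a law on $\mathbb R^k$ with an a.e. positive density $\psi$, and $J(\mathbf v)=1/\psi(T\mathbf v)$ (this allows auxiliary mixing variables, e.g. $s=k+1$). Put $\tilde h(\mathbf v;\mathbf m)=h(T\mathbf v;\mathbf m)\,J(\mathbf v)$. Let $M\subset\mathbb R^d$ be compact and let $M_{k,p}=\{(m_{p_1},\dots,m_{p_k}):\mathbf m\in M\}$. Assume that $\tilde h(\cdot;\mathbf m)\in L^2([0,1]^s)$ for every $\mathbf m\in M_{k,p}$. *Sampling points.* Let $(\mathbf v_n)_{n\ge1}$ be a (base 2) Sobol sequence in $[0,1]^s$ with uniformly bounded gain coefficients: there is $\Gamma<\infty$ such that, for all $N=2^r$ with $r\ge 0$, all nonempty $u\subseteq\{1,\dots,s\}$ and all $\kappa\in\mathbb N_0^u$, $$\frac1N\sum_{n,n'=1}^N\ \prod_{j\in u}\Bigl(2\cdot\mathbf 1_{\lfloor 2^{\kappa_j+1}v_{n,j}\rfloor=\lfloor 2^{\kappa_j+1}v_{n',j}\rfloor}-\mathbf 1_{\lfloor 2^{\kappa_j}v_{n,j}\rfloor=\lfloor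 2^{\kappa_j}v_{n',j}\rfloor}\Bigr)\le\Gamma .$$ Fix $\bar S\ge1$ and, for each $i=1,\dots,\bar S$, let $(\mathbf v_n^{(i)})_{n\ge1}$ be obtained from $(\mathbf v_n)_{n\ge1}$ by nested uniform scrambling in base 2: the $l$-th binary digit of each coordinate is permuted by a random permutation of $\{0,1\}$ attached to the coordinate and to the $l-1$ preceding unscrambled digits, and for each $i$ all these permutations are independent and uniformly distributed. *Claim.* Almost surely with respect to the scrambling, $$\sup_{\mathbf m\in M_{k,p}}\Bigl\|\frac1{\bar S}\sum_{i=1}^{\bar S}\frac1N\sum_{n=1}^N\tilde h\bigl(\mathbf v_n^{(i)};\mathbf m\bigr)-\hat g^{(\nu),\mathrm{Fou}}_{k,p}(\mathbf m)\Bigr\|\longrightarrow0\qquad(N\to\infty),$$ where $\|\cdot\|$ is the modulus, Euclidean norm or Frobenius norm for $\nu=0,1,2$, respectively. -/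

import Mathlib

open MeasureTheory ProbabilityTheory Filter Topology
open scoped ENNReal Polynomial

namespace FourierRQMC

noncomputable section

/-! ### Sobol sequences -/

/-- A primitive polynomial over the field with two elements: it is irreducible and its root
generates the multiplicative group of the residue field, which has `2 ^ deg p - 1` elements. -/
def IsPrimitiveF2 (p : (ZMod 2)[X]) : Prop :=
  Irreducible p ∧ orderOf (AdjoinRoot.root p) = 2 ^ p.natDegree - 1

/-- Binary direction numbers `v_0, v_1, …` of one coordinate of a Sobol sequence: `V l i` is the
digit of `v_l` at position `2 ^ (-(i + 1))`. The direction number `v_l` is an odd multiple of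
`2 ^ (-(l + 1))` in `(0, 1)`. Either the coordinate is the van der Corput coordinate (attached
to the constant polynomial `1`), or the direction numbers are generated by the linear recurrence
`v_{l+r} = ∑_{c < r} p_c v_{l+c} + 2 ^ (-r) v_l` (sums are bitwise, i.e. modulo 2) of a primitive
polynomial `p = ∑_c p_c X ^ c` of degree `r`, with free initial values. -/
structure IsSobolDirections (p : (ZMod 2)[X]) (V : ℕ → ℕ → ZMod 2) : Prop where
  diag : ∀ l, V l l = 1
  upper : ∀ l i, l < i → V l i = 0
  generated :
    (p = 1 ∧ ∀ l i, V l i = if i = l then 1 else 0) ∨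
    (IsPrimitiveF2 p ∧ ∀ l i, V (l + p.natDegree) i =
      (∑ c ∈ Finset.range p.natDegree, p.coeff c * V (l + c) i) +
        (if p.natDegree ≤ i then V l (i - p.natDegree) else 0))

/-- The digit at position `2 ^ (-(i + 1))` of the `n`-th point: the bitwise sum of the direction
numbers selected by the binary digits of `n` (all binary digits of `n` at positions `l ≥ n`
vanish). -/
def sobolDigit (V : ℕ → ℕ → ZMod 2) (n i : ℕ) : Fin 2 :=
  let z : ZMod 2 := ∑ l ∈ Finset.range n, if n.testBit l then V l i else 0
  ⟨z.val, z.val_lt⟩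

/-- `x` is a Sobol sequence in `[0,1)^s` (in its natural order, starting with the origin):
every coordinate is built from direction numbers, and the polynomials attached to different
coordinates are different. -/
def IsSobolSequence {s : ℕ} (x : ℕ → Fin s → ℝ) : Prop :=
  ∃ (p : Fin s → (ZMod 2)[X]) (V : Fin s → ℕ → ℕ → ZMod 2),
    Function.Injective p ∧ (∀ j, IsSobolDirections (p j) (V j)) ∧
    ∀ n j, x n j = Real.ofDigits (sobolDigit (V j) n)

/-! ### Gain coefficients -/

/-- `1` if `y` and `z` lie in the same dyadic interval of length `2 ^ (-c)`, else `0`. -/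
def sameCell (c : ℕ) (y z : ℝ) : ℝ :=
  if ⌊2 ^ c * y⌋ = ⌊2 ^ c * z⌋ then 1 else 0

/-- The base-2 gain coefficient of the first `n` points of `x` for the coordinates in `u` and the
resolution levels `κ j`, `j ∈ u` (the values of `κ` off `u` are irrelevant). -/
def gainCoefficient {s : ℕ} (x : ℕ → Fin s → ℝ) (n : ℕ) (u : Finset (Fin s)) (κ : Fin s → ℕ) :
    ℝ :=
  (n : ℝ)⁻¹ * ∑ i ∈ Finset.range n, ∑ i' ∈ Finset.range n,
    ∏ j ∈ u, (2 * sameCell (κ j + 1) (x i j) (x i' j) - sameCell (κ j) (x i j) (x i' j))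

/-- The gain coefficients of the initial segments of length `2 ^ m` are bounded uniformly in `m`,
in the nonempty coordinate set and in the resolution levels. -/
def HasBoundedGain {s : ℕ} (x : ℕ → Fin s → ℝ) : Prop :=
  ∃ Γ : ℝ, ∀ (m : ℕ) (u : Finset (Fin s)), u.Nonempty → ∀ κ : Fin s → ℕ,
    gainCoefficient x (2 ^ m) u κ ≤ Γ

/-! ### Nested uniform scrambling (base 2) -/

/-- Scramble one real number: its `i`-th binary digit is permuted by the permutation attached to
the list of the preceding (unscrambled) digits. -/
def scrambleCoord (π : List (Fin 2) → Equiv.Perm (Fin 2)) (x : ℝ) : ℝ :=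
  Real.ofDigits fun i =>
    π (List.ofFn fun l : Fin i => Real.digits x 2 l) (Real.digits x 2 i)

/-- Scramble a point coordinate by coordinate, with one family of permutations per coordinate. -/
def scramble {s : ℕ} (π : Fin s → List (Fin 2) → Equiv.Perm (Fin 2)) (x : Fin s → ℝ) :
    Fin s → ℝ :=
  fun j => scrambleCoord (π j) (x j)

/-- The random permutations of a nested uniform scramble: all of them, over all coordinates and
all digit prefixes, are independent and uniformly distributed. -/
structure IsNestedUniformScramble {Ω : Type*} [MeasurableSpace Ω] (Q : Measure Ω) {s : ℕ}
    (π : Ω → Fin s → List (Fin 2) → Equiv.Perm (Fin 2)) : Prop where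
  measurable : ∀ j w σ, MeasurableSet {ω | π ω j w = σ}
  uniform : ∀ j w σ, Q {ω | π ω j w = σ} = (Fintype.card (Equiv.Perm (Fin 2)) : ℝ≥0∞)⁻¹
  indep : iIndepFun (m := fun _ => ⊤)
    (fun (a : Fin s × List (Fin 2)) (ω : Ω) => π ω a.1 a.2) Q

/-- The randomized quadrature average over `S` replicates of `N` points each. -/
def rqmcEstimator {s S : ℕ} {E : Type*} [AddCommGroup E] [Module ℝ E]
    (v : Fin S → ℕ → Fin s → ℝ) (N : ℕ) (f : (Fin s → ℝ) → E) : E :=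
  (S : ℝ)⁻¹ • ∑ r : Fin S, (N : ℝ)⁻¹ • ∑ n ∈ Finset.range N, f (v r n)

/-! ### Fourier integrands -/

/-- The complex point `u + i K`. -/
def contour {k : ℕ} (u K : Fin k → ℝ) : Fin k → ℂ :=
  fun j => (u j : ℂ) + Complex.I * (K j : ℂ)

/-- The extended characteristic function `y ↦ E[exp(i⟨y, X⟩)]`, `y ∈ ℂ^k`. -/
def extCharFun {Ω : Type*} [MeasurableSpace Ω] (P : Measure Ω) {k : ℕ} (X : Ω → Fin k → ℝ)
    (y : Fin k → ℂ) : ℂ :=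
  ∫ ω, Complex.exp (Complex.I * ∑ j, y j * (X ω j : ℂ)) ∂P

/-- The extended Fourier transform `y ↦ ∫ exp(-i⟨y, x⟩) f(x) dx`, `y ∈ ℂ^k`. -/
def extFourier {k : ℕ} (f : (Fin k → ℝ) → ℝ) (y : Fin k → ℂ) : ℂ :=
  ∫ x, Complex.exp (-Complex.I * ∑ j, y j * (x j : ℂ)) * (f x : ℂ)

/-- The entry `∂_{α 0} ⋯ ∂_{α (ν - 1)} ℓ` of the `ν`-th derivative of `ℓ`: the value of `ℓ` for
`ν = 0`, the entries of the gradient for `ν = 1`, of the Hessian for `ν = 2`. -/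
def lossDeriv {k : ℕ} (ℓ : (Fin k → ℝ) → ℝ) (ν : ℕ) (α : Fin ν → Fin k) (x : Fin k → ℝ) : ℝ :=
  iteratedFDeriv ℝ ν ℓ x fun i => Pi.single (α i) 1

/-- `K` is an admissible damping vector for the loss `ℓ` and the random vector `X` at derivative
order `ν`: the extended characteristic function of `X` and the Fourier transforms of the entries
of the `ν`-th derivative of `ℓ` are given by absolutely convergent integrals on the contour
`ℝ^k + i K`, and their product is integrable along this contour. -/
structure AdmissibleDamping {Ω : Type*} [MeasurableSpace Ω] (P : Measure Ω) {k : ℕ}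
    (X : Ω → Fin k → ℝ) (ℓ : (Fin k → ℝ) → ℝ) (ν : ℕ) (K : Fin k → ℝ) : Prop where
  integrable_exp : Integrable (fun ω => Real.exp (-∑ j, K j * X ω j)) P
  integrable_loss : ∀ α : Fin ν → Fin k,
    Integrable fun x : Fin k → ℝ => Real.exp (∑ j, K j * x j) * lossDeriv ℓ ν α x
  integrable_prod : ∀ α : Fin ν → Fin k, Integrable fun u : Fin k → ℝ =>
    extCharFun P X (contour u K) * extFourier (lossDeriv ℓ ν α) (contour u K)

/-- The Fourier integrand `h^{(ν)}(u; m)`, a number, vector or matrix of complex numbers for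
`ν = 0, 1, 2`, with the modulus, the Euclidean norm or the Frobenius norm. -/
def fourierIntegrand {Ω : Type*} [MeasurableSpace Ω] (P : Measure Ω) {k : ℕ}
    (X : Ω → Fin k → ℝ) (ℓ : (Fin k → ℝ) → ℝ) (ν : ℕ) (K m u : Fin k → ℝ) :
    EuclideanSpace ℂ (Fin ν → Fin k) :=
  WithLp.toLp 2 fun α =>
    ((2 * (Real.pi : ℂ)) ^ k)⁻¹ *
      Complex.exp (∑ j, ((K j : ℂ) - Complex.I * (u j : ℂ)) * (m j : ℂ)) *
      extCharFun P X (contour u K) * extFourier (lossDeriv ℓ ν α) (contour u K)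

/-- The Fourier integral `ĝ^{(ν)}(m) = Re ∫ h^{(ν)}(u; m) du`, the real part being taken entry by
entry. -/
def fourierIntegral {Ω : Type*} [MeasurableSpace Ω] (P : Measure Ω) {k : ℕ}
    (X : Ω → Fin k → ℝ) (ℓ : (Fin k → ℝ) → ℝ) (ν : ℕ) (K m : Fin k → ℝ) :
    EuclideanSpace ℂ (Fin ν → Fin k) :=
  WithLp.toLp 2 fun α => (((∫ u, fourierIntegrand P X ℓ ν K m u α).re : ℝ) : ℂ)

/-! ### Domain transformations -/

/-- A transformation `T` from the unit cube `[0,1]^s` to `ℝ^k` together with its weight `J`, used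
to move integrals over `ℝ^k` to the cube.
* `changeOfVariables` (`s = k`): `T` is the inverse of an almost everywhere defined map
  `G : ℝ^k → [0,1]^k`; up to null sets on both sides, it is a differentiable bijection from
  the open cube to `ℝ^k`, and its weight is `|det T'|`.
* `referenceDensity`: `T` transports the uniform distribution on `[0,1]^s` to a distribution on
  `ℝ^k` with an almost everywhere positive density `ψ`, and its weight is `1 / ψ(T v)`; this
  allows auxiliary mixing coordinates, i.e. `s > k`. -/
inductive IsDomainTransform {k : ℕ} :
    {s : ℕ} → ((Fin s → ℝ) → (Fin k → ℝ)) → ((Fin s → ℝ) → ℝ) → Prop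
  | changeOfVariables (T : (Fin k → ℝ) → (Fin k → ℝ)) (S : Set (Fin k → ℝ))
      (measurableSet : MeasurableSet S)
      (subset : S ⊆ interior (Set.Icc 0 1))
      (full : volume (Set.Icc (0 : Fin k → ℝ) 1 \ S) = 0)
      (injOn : Set.InjOn T S)
      (differentiable : ∀ v ∈ S, DifferentiableAt ℝ T v)
      (surjective : volume (T '' S)ᶜ = 0) :
      IsDomainTransform T fun v => |(fderiv ℝ T v).det|
  | referenceDensity {s : ℕ} (T : (Fin s → ℝ) → (Fin k → ℝ)) (ψ : (Fin k → ℝ) → ℝ)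
      (aemeasurable : AEMeasurable T (volume.restrict (Set.Icc 0 1)))
      (measurable : Measurable ψ)
      (positive : ∀ᵐ u, 0 < ψ u)
      (law : Measure.map T (volume.restrict (Set.Icc 0 1)) =
        volume.withDensity fun u => ENNReal.ofReal (ψ u)) :
      IsDomainTransform T fun v => (ψ (T v))⁻¹

/-- The transformed integrand `h̃^{(ν)}(v; m) = h^{(ν)}(T v; m) J(v)` on the unit cube. -/
def transformedIntegrand {Ω : Type*} [MeasurableSpace Ω] (P : Measure Ω) {k s : ℕ}
    (X : Ω → Fin k → ℝ) (ℓ : (Fin k → ℝ) → ℝ) (ν : ℕ) (K : Fin k → ℝ)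
    (T : (Fin s → ℝ) → (Fin k → ℝ)) (J : (Fin s → ℝ) → ℝ) (m : Fin k → ℝ) (v : Fin s → ℝ) :
    EuclideanSpace ℂ (Fin ν → Fin k) :=
  J v • fourierIntegrand P X ℓ ν K m (T v)

/-- The coordinate projection `x ↦ (x_{p_1}, …, x_{p_k})`. -/
def proj {k d : ℕ} (p : Fin k ↪o Fin d) (x : Fin d → ℝ) : Fin k → ℝ :=
  fun j => x (p j)

end

end FourierRQMC

/-!
The estimator is an average of `h̃(·; m)` over scrambled points. Reading `v ↦ h̃(v; ·)` as a function
on the unit cube with values in the Banach space of continuous functions on the compact set of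
parameters, the uniform convergence becomes one strong law of large numbers for a Banach-valued
square integrable function (`IsNestedUniformScramble.strongLaw`). Such a function is obtained from a
single parameter `m₀`, since `h(u; m) = exp ⟨K - i u, m - m₀⟩ h(u; m₀)` with a factor that is
continuous in `(u, m)` and bounded uniformly in `u` (`dampedExpMap`). Its integral is identified by
the change of variables `IsDomainTransform.integral_smul_comp`; the Fourier integral is real because
`h(-u; m)` is conjugate to `h(u; m)` (`fourierIntegral_apply`).

The Banach-valued law follows from the law for nonnegative real functions, applied to indicators and
to the norms of differences in an approximation in `L²`. For nonnegative functions, the partial sums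
are monotone in `N`, so it suffices to have convergence along `N = a * 2 ^ m`, `m → ∞`, for every
`a` (`tendsto_div_of_tendsto_mul_two_pow`). These `N` points are `a` dyadic blocks of length `2 ^ m`,
and the mean square error of the average over one block is at most `Γ / 2 ^ m` times the second
moment of the function, which is summable in `m`.

This bound (`IsNestedUniformScramble.eLpNorm_centredSum_le`) is proved in terms of binary digits. A
scrambled point has independent uniform digits, and the Walsh functions at two scrambled points are
uncorrelated unless they are equal, in which case their covariance is the summand of a gain
coefficient (`IsNestedUniformScramble.integral_walsh_mul_walsh`). This gives the bound for linear
combinations of Walsh functions, which are dense in `L²` by the Stone–Weierstrass theorem. Blocks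
other than the initial one have the same gain coefficients, because the digits of a Sobol sequence in
a block arise from those in the initial block by adding a fixed digit sequence
(`IsSobolSequence.sameCell_block`).
-/

namespace FourierRQMC

/-! ### Binary digits -/

lemma half_add_mem_Ico (d : Fin 2) {y : ℝ} (hy : y ∈ Set.Ico (0 : ℝ) 1) :
    ((d : ℝ) + y) / 2 ∈ Set.Ico (0 : ℝ) 1 := by
  have hd : ((d : ℕ) : ℝ) ≤ 1 := by exact_mod_cast Nat.lt_succ_iff.mp d.isLt
  have hd0 : (0 : ℝ) ≤ ((d : ℕ) : ℝ) := Nat.cast_nonneg _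
  constructor <;> linarith [hy.1, hy.2]

lemma digits_half_add_zero (d : Fin 2) {y : ℝ} (hy : y ∈ Set.Ico (0 : ℝ) 1) :
    Real.digits (((d : ℝ) + y) / 2) 2 0 = d := by
  have h : ⌊((d : ℝ) + y) / 2 * ((2 : ℕ) : ℝ) ^ (0 + 1)⌋₊ = (d : ℕ) := by
    rw [Nat.floor_eq_iff (by have := (half_add_mem_Ico d hy).1; positivity)]
    constructor <;> push_cast <;> linarith [hy.1, hy.2]
  unfold Real.digits
  rw [h]
  exact Fin.ofNat_val_eq_self d

lemma digits_half_add_succ (d : Fin 2) {y : ℝ} (hy : y ∈ Set.Ico (0 : ℝ) 1) (l : ℕ) :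
    Real.digits (((d : ℝ) + y) / 2) 2 (l + 1) = Real.digits y 2 l := by
  have h : ((d : ℝ) + y) / 2 * ((2 : ℕ) : ℝ) ^ (l + 1 + 1)
      = y * ((2 : ℕ) : ℝ) ^ (l + 1) + ((2 * (d * 2 ^ l) : ℕ) : ℝ) := by
    push_cast; ring
  unfold Real.digits
  rw [h, Nat.floor_add_natCast (by have := hy.1; positivity)]
  ext
  simp

/-- The digits of `0.b₀b₁…b_{L-1} + 2^{-L} t` start with `b₀, …, b_{L-1}`. -/
lemma digits_prefix_add {t : ℝ} (ht : t ∈ Set.Ico (0 : ℝ) 1) (L : ℕ) :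
    ∀ b : ℕ → Fin 2,
      (∑ i ∈ Finset.range L, Real.ofDigitsTerm b i + ((2 : ℝ) ^ L)⁻¹ * t ∈ Set.Ico (0 : ℝ) 1) ∧
      ∀ l < L, Real.digits (∑ i ∈ Finset.range L, Real.ofDigitsTerm b i + ((2 : ℝ) ^ L)⁻¹ * t) 2 l
        = b l := by
  induction L with
  | zero => intro b; simpa using ht
  | succ L ih =>
    intro b
    obtain ⟨hmem, hdig⟩ := ih fun i => b (i + 1)
    have key : ∑ i ∈ Finset.range (L + 1), Real.ofDigitsTerm b i + ((2 : ℝ) ^ (L + 1))⁻¹ * t =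
        ((b 0 : ℝ) + (∑ i ∈ Finset.range L, Real.ofDigitsTerm (fun i => b (i + 1)) i
          + ((2 : ℝ) ^ L)⁻¹ * t)) / 2 := by
      rw [Finset.sum_range_succ']
      have : ∀ i, Real.ofDigitsTerm b (i + 1) =
          Real.ofDigitsTerm (fun i => b (i + 1)) i * (1 / 2) := by
        intro i; simp only [Real.ofDigitsTerm, pow_succ, mul_inv]; push_cast; ring
      simp only [this, ← Finset.sum_mul]
      simp only [Real.ofDigitsTerm, pow_succ, mul_inv]
      push_cast; ring
    rw [key]
    refine ⟨half_add_mem_Ico _ hmem, fun l hl => ?_⟩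
    cases l with
    | zero => exact digits_half_add_zero _ hmem
    | succ l => rw [digits_half_add_succ _ hmem, hdig l (by omega)]

lemma ofDigits_eq_of_eventually_zero {b : ℕ → Fin 2} {L : ℕ} (h : ∀ i, L ≤ i → b i = 0) :
    Real.ofDigits b = ∑ i ∈ Finset.range L, Real.ofDigitsTerm b i + ((2 : ℝ) ^ L)⁻¹ * 0 := by
  rw [Real.ofDigits_eq_sum_add_ofDigits b L]
  have : Real.ofDigits (fun i => b (i + L)) = 0 := by
    simp [Real.ofDigits, Real.ofDigitsTerm, h]
  rw [this]; simp

lemma ofDigits_mem_Ico_of_eventually_zero {b : ℕ → Fin 2} {L : ℕ} (h : ∀ i, L ≤ i → b i = 0) :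
    Real.ofDigits b ∈ Set.Ico (0 : ℝ) 1 := by
  rw [ofDigits_eq_of_eventually_zero h]
  exact (digits_prefix_add (by simp) L b).1

lemma digits_ofDigits_of_eventually_zero {b : ℕ → Fin 2} {L : ℕ} (h : ∀ i, L ≤ i → b i = 0) :
    Real.digits (Real.ofDigits b) 2 = b := by
  funext l
  have h' : ∀ i, L + l + 1 ≤ i → b i = 0 := fun i hi => h i (by omega)
  rw [ofDigits_eq_of_eventually_zero h']
  exact (digits_prefix_add (by simp) _ b).2 l (by omega)

/-- The `l`-th digit of a number is determined by its dyadic cell of order `c > l`. -/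
lemma digits_eq_of_floor_eq {y z : ℝ} {c l : ℕ} (hl : l < c)
    (h : ⌊(2 : ℝ) ^ c * y⌋₊ = ⌊(2 : ℝ) ^ c * z⌋₊) : Real.digits y 2 l = Real.digits z 2 l := by
  have key : ∀ y : ℝ, ⌊y * ((2 : ℕ) : ℝ) ^ (l + 1)⌋₊ = ⌊(2 : ℝ) ^ c * y⌋₊ / 2 ^ (c - (l + 1)) := by
    intro y
    rw [← Nat.floor_div_natCast]
    congr 1
    have : (2 : ℝ) ^ c = 2 ^ (l + 1) * 2 ^ (c - (l + 1)) := by rw [← pow_add]; congr 1; omega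
    rw [this]; push_cast; field_simp
  simp only [Real.digits, key, h]

/-- Two points of `[0, 1)` lie in the same dyadic cell of order `c` iff their first `c` digits
agree. -/
lemma sameCell_eq_ite {y z : ℝ} (hy : y ∈ Set.Ico (0 : ℝ) 1) (hz : z ∈ Set.Ico (0 : ℝ) 1) (c : ℕ) :
    sameCell c y z = if ∀ l < c, Real.digits y 2 l = Real.digits z 2 l then 1 else 0 := by
  unfold sameCell
  refine if_congr ?_ rfl rfl
  have hy0 : 0 ≤ (2 : ℝ) ^ c * y := by have := hy.1; positivity
  have hz0 : 0 ≤ (2 : ℝ) ^ c * z := by have := hz.1; positivity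
  rw [← Int.natCast_floor_eq_floor hy0, ← Int.natCast_floor_eq_floor hz0, Nat.cast_inj]
  constructor
  · exact fun h l hl => digits_eq_of_floor_eq hl h
  · intro h
    have hy' := Real.ofDigits_digits_sum_eq (b := 2) hy c
    have hz' := Real.ofDigits_digits_sum_eq (b := 2) hz c
    have : ∑ i ∈ Finset.range c, Real.ofDigitsTerm (Real.digits y 2) i
        = ∑ i ∈ Finset.range c, Real.ofDigitsTerm (Real.digits z 2) i :=
      Finset.sum_congr rfl fun i hi => by
        simp [Real.ofDigitsTerm, h i (Finset.mem_range.mp hi)]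
    rw [this, hz'] at hy'
    push_cast at hy'
    exact_mod_cast hy'.symm

lemma measurable_digits (l : ℕ) : Measurable fun x : ℝ => Real.digits x 2 l := by
  unfold Real.digits
  exact (measurable_from_nat (f := fun n => Fin.ofNat 2 n)).comp
    (Nat.measurable_floor.comp (measurable_id.mul_const _))

/-! ### Uniform digits and the uniform distribution on the cube -/

/-- The uniform distribution on the binary digits `{0, 1}`. -/
noncomputable def fairDigit : Measure (Fin 2) := (2 : ℝ≥0∞)⁻¹ • Measure.count

lemma fairDigit_singleton (d : Fin 2) : fairDigit {d} = 2⁻¹ := by simp [fairDigit]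

instance : IsProbabilityMeasure fairDigit :=
  ⟨by simp [fairDigit, Measure.count_apply, ENNReal.inv_mul_cancel]⟩

lemma eq_infinitePi_fairDigit {μ : Measure (ℕ → Fin 2)} [IsFiniteMeasure μ]
    (h : ∀ (L : ℕ) (b : ℕ → Fin 2), μ {c | ∀ l < L, c l = b l} = ((2 : ℝ≥0∞) ^ L)⁻¹) :
    μ = Measure.infinitePi fun _ => fairDigit := by
  refine Measure.eq_infinitePi _ fun s t ht => ?_
  rw [← Measure.infinitePi_pi (fun _ : ℕ => fairDigit) fun i _ => ht i]
  obtain ⟨L, hL⟩ : ∃ L, ∀ i ∈ s, i < L := ⟨s.sup id + 1, fun i hi =>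
    Nat.lt_succ_of_le (Finset.le_sup (f := id) hi)⟩
  let pre : (ℕ → Fin 2) → (Fin L → Fin 2) := fun c i => c i
  have hpre : Measurable pre := by fun_prop
  have hmap : μ.map pre = (Measure.infinitePi fun _ : ℕ => fairDigit).map pre := by
    refine Measure.ext_of_singleton fun b => ?_
    rw [Measure.map_apply hpre (measurableSet_singleton b),
      Measure.map_apply hpre (measurableSet_singleton b)]
    let b' : ℕ → Fin 2 := fun i => if hi : i < L then b ⟨i, hi⟩ else 0
    have h1 : pre ⁻¹' {b} = {c | ∀ l < L, c l = b' l} := by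
      ext c
      simp only [Set.mem_preimage, Set.mem_singleton_iff, Set.mem_ofPred_eq, pre, funext_iff, b']
      exact ⟨fun h l hl => by simpa [hl] using h ⟨l, hl⟩, fun h l => by simpa using h l l.2⟩
    have h2 : {c : ℕ → Fin 2 | ∀ l < L, c l = b' l}
        = Set.pi (Finset.range L) fun l => {b' l} := by
      ext c; simp [Set.mem_pi]
    rw [h1, h, h2, Measure.infinitePi_pi _ fun i _ => measurableSet_singleton _]
    simp [fairDigit_singleton, ENNReal.inv_pow]
  have hset : Set.pi (s : Set ℕ) t = pre ⁻¹' {b | ∀ i : Fin L, (i : ℕ) ∈ s → b i ∈ t i} := by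
    ext c
    simp only [Set.mem_pi, Finset.mem_coe, Set.mem_preimage, Set.mem_ofPred_eq, pre]
    exact ⟨fun h i hi => h i hi, fun h i hi => h ⟨i, hL i hi⟩ hi⟩
  rw [hset, ← Measure.map_apply hpre (Set.toFinite _).measurableSet, hmap,
    Measure.map_apply hpre (Set.toFinite _).measurableSet]

/-- The binary digits of a uniformly distributed number are independent and uniform. -/
lemma map_digits_volume :
    (volume.restrict (Set.Ico (0 : ℝ) 1)).map (fun x => Real.digits x 2)
      = Measure.infinitePi fun _ => fairDigit := by
  have hm : Measurable fun x : ℝ => Real.digits x 2 := measurable_pi_lambda _ measurable_digits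
  refine eq_infinitePi_fairDigit fun L b => ?_
  have hset : MeasurableSet {c : ℕ → Fin 2 | ∀ l < L, c l = b l} := by
    have : {c : ℕ → Fin 2 | ∀ l < L, c l = b l} = Set.pi (Finset.range L) fun l => {b l} := by
      ext c; simp [Set.mem_pi]
    rw [this]
    exact MeasurableSet.pi (Set.to_countable _) fun _ _ => measurableSet_singleton _
  rw [Measure.map_apply hm hset, Measure.restrict_apply (hm hset)]
  set q : ℝ := ∑ i ∈ Finset.range L, Real.ofDigitsTerm b i with hq
  have h2 : (0 : ℝ) < 2 ^ L := by positivity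
  have : (fun x => Real.digits x 2) ⁻¹' {c | ∀ l < L, c l = b l} ∩ Set.Ico (0 : ℝ) 1
      = Set.Ico q (q + (2 ^ L)⁻¹) := by
    ext x
    simp only [Set.mem_inter_iff, Set.mem_preimage, Set.mem_ofPred_eq]
    constructor
    · rintro ⟨hx, hx1⟩
      have hs : ∑ i ∈ Finset.range L, Real.ofDigitsTerm (Real.digits x 2) i = q :=
        Finset.sum_congr rfl fun i hi => by
          simp [Real.ofDigitsTerm, hx i (Finset.mem_range.mp hi)]
      have hfl := Real.ofDigits_digits_sum_eq (b := 2) hx1 L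
      rw [hs] at hfl
      push_cast at hfl
      have h3 := Nat.floor_le (a := (2 : ℝ) ^ L * x) (by have := hx1.1; positivity)
      have h4 := Nat.lt_floor_add_one ((2 : ℝ) ^ L * x)
      rw [← hfl] at h3 h4
      refine ⟨le_of_mul_le_mul_left h3 h2, ?_⟩
      refine lt_of_mul_lt_mul_left ?_ h2.le
      rw [mul_add, mul_inv_cancel₀ h2.ne']
      exact h4
    · intro hx
      have ht : 2 ^ L * (x - q) ∈ Set.Ico (0 : ℝ) 1 := by
        refine ⟨mul_nonneg h2.le (sub_nonneg.2 hx.1), ?_⟩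
        have := mul_lt_mul_of_pos_left (sub_lt_iff_lt_add'.2 hx.2) h2
        rwa [mul_inv_cancel₀ h2.ne'] at this
      have hx' : x = q + ((2 : ℝ) ^ L)⁻¹ * (2 ^ L * (x - q)) := by field_simp; ring
      have := digits_prefix_add ht L b
      rw [← hq, ← hx'] at this
      exact this.symm
  rw [this, Real.volume_Ico, add_sub_cancel_left, ENNReal.ofReal_inv_of_pos h2,
    ENNReal.ofReal_pow (by norm_num)]
  simp

lemma map_ofDigits_infinitePi :
    (Measure.infinitePi fun _ : ℕ => fairDigit).map Real.ofDigits
      = volume.restrict (Set.Icc (0 : ℝ) 1) := by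
  have hm : Measurable fun x : ℝ => Real.digits x 2 := measurable_pi_lambda _ measurable_digits
  rw [← map_digits_volume, Measure.map_map Real.continuous_ofDigits.measurable hm]
  have : (Real.ofDigits ∘ fun x => Real.digits x 2) =ᵐ[volume.restrict (Set.Ico (0 : ℝ) 1)] id := by
    filter_upwards [ae_restrict_mem measurableSet_Ico] with x hx
    exact Real.ofDigits_digits (by norm_num) hx
  rw [Measure.map_congr this, Measure.map_id]
  exact Measure.restrict_congr_set Ico_ae_eq_Icc

/-- The point of the unit cube with given binary digits. -/
noncomputable def ofDigitArray {s : ℕ} (c : Fin s × ℕ → Fin 2) : Fin s → ℝ :=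
  fun j => Real.ofDigits fun l => c (j, l)

lemma measurable_ofDigitArray {s : ℕ} : Measurable (ofDigitArray (s := s)) := by
  refine measurable_pi_lambda _ fun j => ?_
  exact Real.continuous_ofDigits.measurable.comp (by fun_prop)

/-- A point with independent uniform digits is uniformly distributed on the unit cube. -/
lemma map_ofDigitArray (s : ℕ) :
    (Measure.infinitePi fun _ : Fin s × ℕ => fairDigit).map ofDigitArray
      = volume.restrict (Set.Icc (0 : Fin s → ℝ) 1) := by
  have h1 : (ofDigitArray (s := s)) = (fun c j => Real.ofDigits (c j)) ∘
      MeasurableEquiv.curry (Fin s) ℕ (Fin 2) := rfl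
  have h2 : Measurable fun (c : Fin s → ℕ → Fin 2) j => Real.ofDigits (c j) :=
    measurable_pi_lambda _ fun j => Real.continuous_ofDigits.measurable.comp (measurable_pi_apply j)
  rw [h1, ← Measure.map_map h2 (MeasurableEquiv.measurable _),
    Measure.infinitePi_map_curry (fun _ _ => fairDigit), Measure.infinitePi_eq_pi,
    Measure.pi_map_pi (fun _ => Real.continuous_ofDigits.measurable.aemeasurable),
    ← Set.pi_univ_Icc, volume_pi, Measure.restrict_pi_pi]
  simp_rw [map_ofDigits_infinitePi]
  rfl

/-! ### Walsh functions -/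

/-- The character `d ↦ (-1) ^ d` of the binary digits. -/
noncomputable def digitSign (d : Fin 2) : ℝ := (-1) ^ (d : ℕ)

/-- The Walsh function `c ↦ (-1) ^ (∑_{a ∈ A} c_a)` on arrays of binary digits. -/
noncomputable def walsh {ι : Type*} (A : Finset ι) (c : ι → Fin 2) : ℝ := ∏ a ∈ A, digitSign (c a)

lemma digitSign_mul_self (d : Fin 2) : digitSign d * digitSign d = 1 := by
  rw [digitSign, ← mul_pow]; simp

lemma digitSign_mul (d e : Fin 2) :
    digitSign d * digitSign e = if d = e then 1 else -1 := by
  fin_cases d <;> fin_cases e <;> simp [digitSign]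

lemma abs_digitSign (d : Fin 2) : |digitSign d| = 1 := by simp [digitSign, abs_pow]

lemma abs_walsh {ι : Type*} (A : Finset ι) (c : ι → Fin 2) : |walsh A c| = 1 := by
  simp [walsh, Finset.abs_prod, abs_digitSign]

lemma continuous_digitSign : Continuous digitSign := continuous_of_discreteTopology

lemma continuous_walsh {ι : Type*} (A : Finset ι) : Continuous (walsh A) :=
  continuous_finsetProd _ fun _ _ => continuous_digitSign.comp (continuous_apply _)

lemma measurable_walsh {ι : Type*} (A : Finset ι) : Measurable (walsh A) :=
  Finset.measurable_fun_prod _ fun a _ => continuous_digitSign.measurable.comp (measurable_pi_apply a)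

lemma prod_mul_prod_eq_prod_symmDiff {ι : Type*} [DecidableEq ι] {f : ι → ℝ}
    (hf : ∀ a, f a * f a = 1) (A B : Finset ι) :
    (∏ a ∈ A, f a) * ∏ a ∈ B, f a = ∏ a ∈ symmDiff A B, f a := by
  have hd : symmDiff A B = (A \ B) ∪ (B \ A) := rfl
  have hi : (∏ a ∈ A ∩ B, f a) * ∏ a ∈ A ∩ B, f a = 1 := by
    rw [← Finset.prod_mul_distrib]; exact Finset.prod_eq_one fun a _ => hf a
  rw [hd, Finset.prod_union (disjoint_sdiff_sdiff),
    ← Finset.prod_sdiff (Finset.inter_subset_left : A ∩ B ⊆ A),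
    ← Finset.prod_sdiff (Finset.inter_subset_right : A ∩ B ⊆ B), Finset.sdiff_inter_self_left,
    Finset.sdiff_inter_self_right, mul_mul_mul_comm, hi, mul_one]

lemma walsh_mul {ι : Type*} [DecidableEq ι] (A B : Finset ι) (c : ι → Fin 2) :
    walsh A c * walsh B c = walsh (symmDiff A B) c :=
  prod_mul_prod_eq_prod_symmDiff (fun a => digitSign_mul_self (c a)) A B

/-! ### Nested uniform scrambling -/

/-- The list of the first `l` binary digits of `x`. -/
noncomputable def digitPrefix (x : ℝ) (l : ℕ) : List (Fin 2) :=
  List.ofFn fun i : Fin l => Real.digits x 2 i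

/-- The node of the scrambling tree whose permutation acts on the digit `a.2` of the coordinate
`a.1` of `x`. -/
noncomputable def scrambleNode {s : ℕ} (x : Fin s → ℝ) (a : Fin s × ℕ) : Fin s × List (Fin 2) :=
  (a.1, digitPrefix (x a.1) a.2)

/-- The array of the digits of the scrambled point. -/
noncomputable def scrambledDigits {s : ℕ} (π : Fin s → List (Fin 2) → Equiv.Perm (Fin 2))
    (x : Fin s → ℝ) (a : Fin s × ℕ) : Fin 2 :=
  π a.1 (digitPrefix (x a.1) a.2) (Real.digits (x a.1) 2 a.2)

lemma digitPrefix_eq_iff {x y : ℝ} {l : ℕ} :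
    digitPrefix x l = digitPrefix y l ↔ ∀ i < l, Real.digits x 2 i = Real.digits y 2 i := by
  unfold digitPrefix
  rw [List.ofFn_inj, funext_iff]
  exact ⟨fun h i hi => h ⟨i, hi⟩, fun h i => h i i.2⟩

lemma scrambleNode_eq_iff {s : ℕ} {x y : Fin s → ℝ} {a b : Fin s × ℕ} :
    scrambleNode x a = scrambleNode y b ↔
      a = b ∧ ∀ i < a.2, Real.digits (x a.1) 2 i = Real.digits (y a.1) 2 i := by
  constructor
  · intro h
    have h1 : a.1 = b.1 := congrArg (fun q => q.1) h
    have h2 : a.2 = b.2 := by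
      simpa [scrambleNode, digitPrefix] using congrArg (fun q => q.2.length) h
    obtain rfl : a = b := Prod.ext h1 h2
    exact ⟨rfl, digitPrefix_eq_iff.1 (congrArg (fun q => q.2) h)⟩
  · rintro ⟨rfl, h⟩
    exact Prod.ext rfl (digitPrefix_eq_iff.2 h)

lemma scrambleNode_injective {s : ℕ} (x : Fin s → ℝ) : Function.Injective (scrambleNode x) :=
  fun _ _ h => (scrambleNode_eq_iff.1 h).1

/-- The sign of a permutation, as a real number. -/
noncomputable def permSign (σ : Equiv.Perm (Fin 2)) : ℝ := ((Equiv.Perm.sign σ : ℤ) : ℝ)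

lemma digitSign_perm (σ : Equiv.Perm (Fin 2)) (d : Fin 2) :
    digitSign (σ d) = permSign σ * digitSign d := by
  have h : ∀ (σ : Equiv.Perm (Fin 2)) (d : Fin 2),
      (-1 : ℤ) ^ ((σ d : Fin 2) : ℕ) = (Equiv.Perm.sign σ : ℤ) * (-1) ^ (d : ℕ) := by decide
  have := congrArg (Int.cast : ℤ → ℝ) (h σ d)
  push_cast at this
  exact this

lemma permSign_mul_self (σ : Equiv.Perm (Fin 2)) : permSign σ * permSign σ = 1 := by
  have h : ∀ σ : Equiv.Perm (Fin 2), (Equiv.Perm.sign σ : ℤ) * Equiv.Perm.sign σ = 1 := by decide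
  have := congrArg (Int.cast : ℤ → ℝ) (h σ)
  push_cast at this
  exact this

lemma permSign_eq (σ : Equiv.Perm (Fin 2)) : permSign σ = 2 * (if σ = 1 then 1 else 0) - 1 := by
  have h : ∀ σ : Equiv.Perm (Fin 2), (Equiv.Perm.sign σ : ℤ) = 2 * (if σ = 1 then 1 else 0) - 1 := by
    decide
  have := congrArg (Int.cast : ℤ → ℝ) (h σ)
  push_cast at this
  exact this

section Scramble

variable {Ω : Type*} [MeasurableSpace Ω] {Q : Measure Ω} {s : ℕ}
  {π : Ω → Fin s → List (Fin 2) → Equiv.Perm (Fin 2)}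

lemma IsNestedUniformScramble.measurable_comp (hπ : IsNestedUniformScramble Q π) {β : Type*}
    [MeasurableSpace β] (g : Equiv.Perm (Fin 2) → β) (a : Fin s × List (Fin 2)) :
    Measurable fun ω => g (π ω a.1 a.2) := by
  let _ : MeasurableSpace (Equiv.Perm (Fin 2)) := ⊤
  have h : Measurable fun ω => π ω a.1 a.2 := measurable_to_countable' fun σ => hπ.measurable _ _ σ
  exact measurable_from_top.comp h

lemma IsNestedUniformScramble.iIndepFun_comp (hπ : IsNestedUniformScramble Q π) {β : Type*}
    [MeasurableSpace β] {κ : Type*} (φ : κ → Fin s × List (Fin 2)) (hφ : Function.Injective φ)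
    (g : κ → Equiv.Perm (Fin 2) → β) :
    iIndepFun (fun a ω => g a (π ω (φ a).1 (φ a).2)) Q := by
  let _ : MeasurableSpace (Equiv.Perm (Fin 2)) := ⊤
  exact (hπ.indep.precomp hφ).comp (g := g) fun _ => measurable_from_top

lemma IsNestedUniformScramble.measure_eq (hπ : IsNestedUniformScramble Q π) (j : Fin s)
    (w : List (Fin 2)) (σ : Equiv.Perm (Fin 2)) : Q {ω | π ω j w = σ} = 2⁻¹ := by
  rw [hπ.uniform, Fintype.card_perm]
  simp

lemma IsNestedUniformScramble.measurable_scrambledDigits (hπ : IsNestedUniformScramble Q π)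
    (x : Fin s → ℝ) : Measurable fun ω => scrambledDigits (π ω) x :=
  measurable_pi_lambda _ fun a => hπ.measurable_comp (fun σ => σ (Real.digits (x a.1) 2 a.2))
    (scrambleNode x a)

/-- The digits of a scrambled point are independent and uniformly distributed. -/
lemma IsNestedUniformScramble.map_scrambledDigits (hπ : IsNestedUniformScramble Q π)
    (x : Fin s → ℝ) :
    Q.map (fun ω => scrambledDigits (π ω) x) = Measure.infinitePi fun _ => fairDigit := by
  have hm : ∀ a, Measurable fun ω => scrambledDigits (π ω) x a := fun a =>
    hπ.measurable_comp (fun σ => σ (Real.digits (x a.1) 2 a.2)) (scrambleNode x a)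
  have hind : iIndepFun (fun a ω => scrambledDigits (π ω) x a) Q :=
    hπ.iIndepFun_comp (β := Fin 2) (scrambleNode x) (scrambleNode_injective x)
      fun a σ => σ (Real.digits (x a.1) 2 a.2)
  have hlaw : ∀ a, Q.map (fun ω => scrambledDigits (π ω) x a) = fairDigit := by
    intro a
    refine Measure.ext_of_singleton fun b => ?_
    rw [Measure.map_apply (hm a) (measurableSet_singleton b), fairDigit_singleton]
    have hσ : ∀ d b : Fin 2, ∃ σ : Equiv.Perm (Fin 2), ∀ τ : Equiv.Perm (Fin 2),
        τ d = b ↔ τ = σ := by decide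
    obtain ⟨σ, hσ⟩ := hσ (Real.digits (x a.1) 2 a.2) b
    rw [← hπ.measure_eq (scrambleNode x a).1 (scrambleNode x a).2 σ]
    congr 1
    ext ω
    exact hσ _
  rw [hind.map_fun_eq_infinitePi_map hm]
  simp_rw [hlaw]

/-- A scrambled point is uniformly distributed on the unit cube. -/
lemma IsNestedUniformScramble.map_scramble (hπ : IsNestedUniformScramble Q π) (x : Fin s → ℝ) :
    Q.map (fun ω => scramble (π ω) x) = volume.restrict (Set.Icc (0 : Fin s → ℝ) 1) := by
  rw [← map_ofDigitArray, ← hπ.map_scrambledDigits x,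
    Measure.map_map measurable_ofDigitArray (hπ.measurable_scrambledDigits x)]
  rfl

lemma IsNestedUniformScramble.measurable_scramble (hπ : IsNestedUniformScramble Q π)
    (x : Fin s → ℝ) : Measurable fun ω => scramble (π ω) x :=
  measurable_ofDigitArray.comp (hπ.measurable_scrambledDigits x)

variable [IsProbabilityMeasure Q]

lemma IsNestedUniformScramble.integral_permSign (hπ : IsNestedUniformScramble Q π)
    (a : Fin s × List (Fin 2)) : ∫ ω, permSign (π ω a.1 a.2) ∂Q = 0 := by
  have hm := hπ.measurable a.1 a.2 1
  have h : (fun ω => permSign (π ω a.1 a.2))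
      = fun ω => 2 * ({ω | π ω a.1 a.2 = 1}.indicator (fun _ => (1 : ℝ)) ω) - 1 := by
    funext ω
    rw [permSign_eq]
    simp only [Set.indicator, Set.mem_ofPred_eq]
  rw [h, integral_sub (((integrable_const _).indicator hm).const_mul _) (integrable_const _),
    integral_const_mul, integral_indicator_const _ hm, measureReal_def, hπ.measure_eq]
  simp

lemma IsNestedUniformScramble.integral_prod_permSign (hπ : IsNestedUniformScramble Q π)
    (A : Finset (Fin s × List (Fin 2))) :
    ∫ ω, ∏ a ∈ A, permSign (π ω a.1 a.2) ∂Q = if A = ∅ then 1 else 0 := by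
  have h := (hπ.iIndepFun_comp (fun a : A => (a : Fin s × List (Fin 2))) Subtype.val_injective
    (fun _ => permSign)).integral_fun_prod_eq_prod_integral
    fun a => (hπ.measurable_comp permSign a).aestronglyMeasurable
  simp only [hπ.integral_permSign, Finset.prod_const, Finset.card_univ, Fintype.card_coe] at h
  have h' : ∀ ω, ∏ a ∈ A, permSign (π ω a.1 a.2)
      = ∏ a : A, permSign (π ω (a : Fin s × List (Fin 2)).1 (a : Fin s × List (Fin 2)).2) :=
    fun ω => (Finset.prod_coe_sort A fun a => permSign (π ω a.1 a.2)).symm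
  simp only [h', h]
  rcases A.eq_empty_or_nonempty with rfl | hA
  · simp
  · rw [if_neg hA.ne_empty, zero_pow hA.card_ne_zero]

/-- The largest digit position of `A` in the coordinate `j`. -/
def topLevel (A : Finset (Fin s × ℕ)) (j : Fin s) : ℕ := (A.filter fun a => a.1 = j).sup Prod.snd

/-- The summand of the gain coefficient that belongs to the Walsh function `A`: its coordinates
are those occurring in `A` and its levels are the largest digit positions in them. -/
noncomputable def gainKernel (A : Finset (Fin s × ℕ)) (x y : Fin s → ℝ) : ℝ :=
  ∏ j ∈ A.image Prod.fst,
    (2 * sameCell (topLevel A j + 1) (x j) (y j) - sameCell (topLevel A j) (x j) (y j))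

lemma exists_mem_topLevel {A : Finset (Fin s × ℕ)} {j : Fin s} (hj : j ∈ A.image Prod.fst) :
    (j, topLevel A j) ∈ A := by
  obtain ⟨a, ha, rfl⟩ := Finset.mem_image.1 hj
  obtain ⟨b, hb, hb'⟩ := Finset.exists_mem_eq_sup (A.filter fun b => b.1 = a.1)
    ⟨a, by simp [ha]⟩ Prod.snd
  rw [Finset.mem_filter] at hb
  have : (a.1, topLevel A a.1) = b := Prod.ext hb.2.symm hb'
  rw [this]; exact hb.1

lemma le_topLevel {A : Finset (Fin s × ℕ)} {a : Fin s × ℕ} (ha : a ∈ A) : a.2 ≤ topLevel A a.1 :=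
  Finset.le_sup (f := Prod.snd) (Finset.mem_filter.2 ⟨ha, rfl⟩)

lemma gainKernel_eq_ite {x y : Fin s → ℝ} (hx : ∀ j, x j ∈ Set.Ico (0 : ℝ) 1)
    (hy : ∀ j, y j ∈ Set.Ico (0 : ℝ) 1) (A : Finset (Fin s × ℕ)) :
    gainKernel A x y =
      if ∀ a ∈ A, ∀ i < a.2, Real.digits (x a.1) 2 i = Real.digits (y a.1) 2 i then
        ∏ a ∈ A, digitSign (Real.digits (x a.1) 2 a.2) * digitSign (Real.digits (y a.1) 2 a.2)
      else 0 := by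
  unfold gainKernel
  simp only [sameCell_eq_ite (hx _) (hy _)]
  split_ifs with h
  · rw [← Finset.prod_fiberwise_of_maps_to (g := Prod.fst) (t := A.image Prod.fst)
      fun a ha => Finset.mem_image_of_mem _ ha]
    refine Finset.prod_congr rfl fun j hj => ?_
    have hjA := exists_mem_topLevel hj
    have hag := h _ hjA
    simp only at hag
    rw [Finset.prod_eq_single_of_mem (s := A.filter fun a => a.1 = j) (j, topLevel A j)
      (Finset.mem_filter.2 ⟨hjA, rfl⟩), if_pos hag,
      digitSign_mul]
    · simp only
      by_cases hd : Real.digits (x j) 2 (topLevel A j) = Real.digits (y j) 2 (topLevel A j)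
      · rw [if_pos hd, if_pos]
        · norm_num
        · intro l hl
          rcases Nat.lt_succ_iff_lt_or_eq.1 hl with hl | rfl
          · exact hag l hl
          · exact hd
      · rw [if_neg hd, if_neg fun h' => hd (h' _ (Nat.lt_succ_self _))]
        norm_num
    · -- all digits of `x` and `y` at positions in `A` below the top level agree
      intro a ha hne
      obtain ⟨haA, rfl⟩ := Finset.mem_filter.1 ha
      have hlt : a.2 < topLevel A a.1 :=
        lt_of_le_of_ne (le_topLevel haA) fun h' => hne (Prod.ext rfl h')
      rw [hag _ hlt, digitSign_mul_self]
  · push Not at h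
    obtain ⟨a, ha, i, hi, hne⟩ := h
    have hia : i < topLevel A a.1 := hi.trans_le (le_topLevel ha)
    refine Finset.prod_eq_zero (Finset.mem_image_of_mem Prod.fst ha) ?_
    rw [if_neg fun h' => hne (h' i (by omega)), if_neg fun h' => hne (h' i hia)]
    norm_num

lemma walsh_scrambledDigits (τ : Fin s → List (Fin 2) → Equiv.Perm (Fin 2)) (x : Fin s → ℝ)
    (A : Finset (Fin s × ℕ)) :
    walsh A (scrambledDigits τ x) =
      (∏ b ∈ A.image (scrambleNode x), permSign (τ b.1 b.2)) *
        ∏ a ∈ A, digitSign (Real.digits (x a.1) 2 a.2) := by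
  rw [Finset.prod_image (scrambleNode_injective x).injOn, ← Finset.prod_mul_distrib]
  exact Finset.prod_congr rfl fun a _ => digitSign_perm _ _

lemma image_scrambleNode_eq_iff {x y : Fin s → ℝ} {A B : Finset (Fin s × ℕ)} :
    A.image (scrambleNode x) = B.image (scrambleNode y) ↔
      A = B ∧ ∀ a ∈ A, ∀ i < a.2, Real.digits (x a.1) 2 i = Real.digits (y a.1) 2 i := by
  constructor
  · intro h
    have h1 : ∀ a ∈ A, a ∈ B ∧ ∀ i < a.2, Real.digits (x a.1) 2 i = Real.digits (y a.1) 2 i := by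
      intro a ha
      have hm : scrambleNode x a ∈ B.image (scrambleNode y) := h ▸ Finset.mem_image_of_mem _ ha
      obtain ⟨b, hb, hab⟩ := Finset.mem_image.1 hm
      obtain ⟨rfl, hd⟩ := scrambleNode_eq_iff.1 hab.symm
      exact ⟨hb, hd⟩
    refine ⟨Finset.Subset.antisymm (fun a ha => (h1 a ha).1) fun b hb => ?_, fun a ha => (h1 a ha).2⟩
    have hm : scrambleNode y b ∈ A.image (scrambleNode x) := h ▸ Finset.mem_image_of_mem _ hb
    obtain ⟨a, ha, hab⟩ := Finset.mem_image.1 hm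
    exact (scrambleNode_eq_iff.1 hab).1 ▸ ha
  · rintro ⟨rfl, h⟩
    exact Finset.image_congr fun a ha => scrambleNode_eq_iff.2 ⟨rfl, h a ha⟩

/-- The covariances of the Walsh functions at two scrambled points: different Walsh functions are
uncorrelated, and equal ones produce the summands of the gain coefficients. -/
lemma IsNestedUniformScramble.integral_walsh_mul_walsh (hπ : IsNestedUniformScramble Q π)
    {x y : Fin s → ℝ} (hx : ∀ j, x j ∈ Set.Ico (0 : ℝ) 1) (hy : ∀ j, y j ∈ Set.Ico (0 : ℝ) 1)
    (A B : Finset (Fin s × ℕ)) :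
    ∫ ω, walsh A (scrambledDigits (π ω) x) * walsh B (scrambledDigits (π ω) y) ∂Q =
      if A = B then gainKernel A x y else 0 := by
  have h : ∀ ω, walsh A (scrambledDigits (π ω) x) * walsh B (scrambledDigits (π ω) y) =
      (∏ b ∈ symmDiff (A.image (scrambleNode x)) (B.image (scrambleNode y)),
        permSign (π ω b.1 b.2)) *
      ((∏ a ∈ A, digitSign (Real.digits (x a.1) 2 a.2)) *
        ∏ a ∈ B, digitSign (Real.digits (y a.1) 2 a.2)) := by
    intro ω
    rw [walsh_scrambledDigits, walsh_scrambledDigits, mul_mul_mul_comm,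
      prod_mul_prod_eq_prod_symmDiff fun b => permSign_mul_self _]
  simp only [h]
  rw [integral_mul_const, hπ.integral_prod_permSign]
  simp only [← Finset.bot_eq_empty, symmDiff_eq_bot, image_scrambleNode_eq_iff]
  by_cases hAB : A = B
  · subst hAB
    rw [if_pos rfl, gainKernel_eq_ite hx hy]
    simp only [true_and, Finset.prod_mul_distrib]
    split_ifs <;> simp
  · simp [hAB]

end Scramble

/-! ### Dyadic blocks of a Sobol sequence -/

/-- The digit sum in the definition of `sobolDigit` may be extended to any longer range. -/
lemma sobolDigit_val (V : ℕ → ℕ → ZMod 2) {n L : ℕ} (h : n ≤ L) (i : ℕ) :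
    (sobolDigit V n i : ℕ)
      = (∑ l ∈ Finset.range L, if n.testBit l then V l i else 0 : ZMod 2).val := by
  have : ∑ l ∈ Finset.range n, (if n.testBit l then V l i else 0)
      = ∑ l ∈ Finset.range L, if n.testBit l then V l i else 0 := by
    refine Finset.sum_subset (Finset.range_mono h) fun l _ hl => ?_
    rw [Nat.testBit_lt_two_pow (n.lt_two_pow_self.trans_le
      (Nat.pow_le_pow_right (by norm_num) (not_lt.1 fun h' => hl (Finset.mem_range.2 h'))))]
    simp
  rw [← this]
  rfl

lemma sobolDigit_eq_zero {V : ℕ → ℕ → ZMod 2} (hV : ∀ l i, l < i → V l i = 0) {n i : ℕ}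
    (h : n ≤ i) : sobolDigit V n i = 0 := by
  ext
  rw [sobolDigit_val V le_rfl, Finset.sum_eq_zero]
  · simp
  · intro l hl
    rw [hV l i ((Finset.mem_range.1 hl).trans_le h)]
    simp

/-- Inside a dyadic block `2 ^ m * a, …, 2 ^ m * a + 2 ^ m - 1`, the digits are those of the
initial block, shifted by a digit sequence that depends on the block only. -/
lemma exists_sobolDigit_block_shift (V : ℕ → ℕ → ZMod 2) (m a : ℕ) (l : ℕ) :
    ∃ t : ZMod 2, ∀ i < 2 ^ m,
      (sobolDigit V (2 ^ m * a + i) l : ℕ) = (t + (sobolDigit V i l : ℕ) : ZMod 2).val := by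
  set L := 2 ^ m * a + 2 ^ m with hL
  refine ⟨∑ r ∈ Finset.range L, if r < m then 0 else if a.testBit (r - m) then V r l else 0,
    fun i hi => ?_⟩
  have hiL : i ≤ L := by omega
  rw [sobolDigit_val V (L := L) (by omega), sobolDigit_val V hiL, ZMod.natCast_zmod_val,
    ← Finset.sum_add_distrib]
  congr 1
  refine Finset.sum_congr rfl fun r _ => ?_
  rw [Nat.testBit_two_pow_mul_add _ hi]
  by_cases hr : r < m
  · simp [hr]
  · have : i.testBit r = false :=
      Nat.testBit_lt_two_pow (hi.trans_le (Nat.pow_le_pow_right (by norm_num) (not_lt.1 hr)))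
    simp [hr, this]

lemma sobolDigit_block_eq_iff (V : ℕ → ℕ → ZMod 2) {m : ℕ} (a : ℕ) {i i' : ℕ} (hi : i < 2 ^ m)
    (hi' : i' < 2 ^ m) (l : ℕ) :
    sobolDigit V (2 ^ m * a + i) l = sobolDigit V (2 ^ m * a + i') l ↔
      sobolDigit V i l = sobolDigit V i' l := by
  obtain ⟨t, ht⟩ := exists_sobolDigit_block_shift V m a l
  rw [Fin.ext_iff, ht i hi, ht i' hi', (ZMod.val_injective 2).eq_iff, add_right_inj, Fin.ext_iff]
  constructor
  · intro h
    have h2 := congrArg ZMod.val h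
    rwa [ZMod.val_natCast_of_lt (sobolDigit V i l).isLt,
      ZMod.val_natCast_of_lt (sobolDigit V i' l).isLt] at h2
  · exact fun h => by rw [h]

section Sobol

variable {s : ℕ} {x : ℕ → Fin s → ℝ}

lemma IsSobolSequence.mem_Ico (hx : IsSobolSequence x) (n : ℕ) (j : Fin s) :
    x n j ∈ Set.Ico (0 : ℝ) 1 := by
  obtain ⟨p, V, -, hV, hxV⟩ := hx
  rw [hxV]
  exact ofDigits_mem_Ico_of_eventually_zero fun i hi => sobolDigit_eq_zero (hV j).upper hi

lemma IsSobolSequence.sameCell_block (hx : IsSobolSequence x) {m : ℕ} (a : ℕ) {i i' : ℕ}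
    (hi : i < 2 ^ m) (hi' : i' < 2 ^ m) (j : Fin s) (c : ℕ) :
    sameCell c (x (2 ^ m * a + i) j) (x (2 ^ m * a + i') j) = sameCell c (x i j) (x i' j) := by
  rw [sameCell_eq_ite (hx.mem_Ico _ j) (hx.mem_Ico _ j), sameCell_eq_ite (hx.mem_Ico _ j)
    (hx.mem_Ico _ j)]
  obtain ⟨p, V, -, hV, hxV⟩ := hx
  have hd : ∀ n, Real.digits (x n j) 2 = sobolDigit (V j) n := fun n => by
    rw [hxV]
    exact digits_ofDigits_of_eventually_zero fun i hi => sobolDigit_eq_zero (hV j).upper hi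
  simp only [hd, sobolDigit_block_eq_iff _ a hi hi']

/-- The gain coefficients of all dyadic blocks of a Sobol sequence are bounded as soon as those of
the initial blocks are. -/
lemma IsSobolSequence.exists_sum_gainKernel_le (hx : IsSobolSequence x) (hg : HasBoundedGain x) :
    ∃ Γ : ℝ, 0 ≤ Γ ∧ ∀ (m a : ℕ) (A : Finset (Fin s × ℕ)), A.Nonempty →
      ∑ i ∈ Finset.range (2 ^ m), ∑ i' ∈ Finset.range (2 ^ m),
        gainKernel A (x (2 ^ m * a + i)) (x (2 ^ m * a + i')) ≤ 2 ^ m * Γ := by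
  obtain ⟨Γ, hΓ⟩ := hg
  refine ⟨max Γ 0, le_max_right _ _, fun m a A hA => ?_⟩
  have h := hΓ m (A.image Prod.fst) (hA.image _) (topLevel A)
  unfold gainCoefficient at h
  rw [inv_mul_le_iff₀ (by positivity)] at h
  push_cast at h
  refine le_trans (le_of_eq ?_) (h.trans (mul_le_mul_of_nonneg_left (le_max_left _ _)
    (by positivity)))
  refine Finset.sum_congr rfl fun i hi => Finset.sum_congr rfl fun i' hi' => ?_
  rw [Finset.mem_range] at hi hi'
  simp only [gainKernel, hx.sameCell_block a hi hi']

end Sobol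

/-! ### Density of the Walsh functions -/

/-- The space of the linear combinations of Walsh functions. -/
noncomputable def walshSpan (ι : Type*) : Submodule ℝ ((ι → Fin 2) → ℝ) :=
  Submodule.span ℝ (Set.range walsh)

lemma one_mem_walshSpan (ι : Type*) : (1 : (ι → Fin 2) → ℝ) ∈ walshSpan ι :=
  Submodule.subset_span ⟨∅, by funext c; simp [walsh]⟩

lemma mul_mem_walshSpan {ι : Type*} {f g : (ι → Fin 2) → ℝ} (hf : f ∈ walshSpan ι)
    (hg : g ∈ walshSpan ι) : f * g ∈ walshSpan ι := by
  classical
  have h := Submodule.mul_mem_mul hf hg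
  unfold walshSpan at h
  rw [Submodule.span_mul_span] at h
  refine Submodule.span_mono ?_ h
  rintro _ ⟨_, ⟨A, rfl⟩, _, ⟨B, rfl⟩, rfl⟩
  exact ⟨symmDiff A B, by funext c; exact (walsh_mul A B c).symm⟩

/-- The algebra of the linear combinations of Walsh functions, as continuous functions. -/
noncomputable def walshAlgebra (ι : Type*) : Subalgebra ℝ C(ι → Fin 2, ℝ) :=
  ((walshSpan ι).toSubalgebra (one_mem_walshSpan ι) fun _ _ => mul_mem_walshSpan).comap
    (ContinuousMap.coeFnAlgHom ℝ)

lemma walshAlgebra_separatesPoints (ι : Type*) : (walshAlgebra ι).SeparatesPoints := by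
  intro c c' hne
  obtain ⟨a, ha⟩ := Function.ne_iff.1 hne
  refine ⟨walsh {a}, ⟨⟨walsh {a}, continuous_walsh _⟩, Submodule.subset_span ⟨{a}, rfl⟩, rfl⟩, ?_⟩
  simp only [walsh, Finset.prod_singleton]
  intro h
  have h1 := digitSign_mul (c a) (c' a)
  rw [if_neg ha, h, digitSign_mul_self] at h1
  norm_num at h1

/-- Linear combinations of Walsh functions are dense in `L²`. -/
lemma exists_walshSpan_eLpNorm_sub_le {ι : Type*} [Countable ι] {ν : Measure (ι → Fin 2)}
    [IsProbabilityMeasure ν] {f : (ι → Fin 2) → ℝ} (hf : MemLp f 2 ν) {ε : ℝ} (hε : 0 < ε) :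
    ∃ p ∈ walshSpan ι, eLpNorm (f - p) 2 ν ≤ ENNReal.ofReal ε := by
  have hε2 : 0 < ε / 2 := half_pos hε
  obtain ⟨g, hg, hgm⟩ := hf.exists_boundedContinuous_eLpNorm_sub_le (by norm_num)
    (ε := ENNReal.ofReal (ε / 2)) (by simpa using hε2)
  obtain ⟨⟨q, hq⟩, hqg⟩ :=
    ContinuousMap.exists_mem_subalgebra_near_continuous_of_separatesPoints (walshAlgebra ι)
      (walshAlgebra_separatesPoints ι) g g.continuous (ε / 2) hε2
  refine ⟨q, hq, ?_⟩
  have hgq : eLpNorm (⇑g - ⇑q) 2 ν ≤ ENNReal.ofReal (ε / 2) := by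
    refine (eLpNorm_le_of_ae_bound (C := ε / 2) (ae_of_all _ fun c => ?_)).trans (by simp)
    rw [Pi.sub_apply, norm_sub_rev]
    exact (hqg c).le
  have hsplit : f - ⇑q = (f - ⇑g) + (⇑g - ⇑q) := by abel
  rw [hsplit, ← add_halves ε, ENNReal.ofReal_add hε2.le hε2.le]
  refine (eLpNorm_add_le (hf.1.sub hgm.1) (hgm.1.sub ?_) (by norm_num)).trans (add_le_add hg hgq)
  exact q.continuous.aestronglyMeasurable

/-! ### The variance of a quadrature block -/

lemma eLpNorm_two_sq {α : Type*} [MeasurableSpace α] {μ : Measure α} {f : α → ℝ}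
    (hf : MemLp f 2 μ) : eLpNorm f 2 μ ^ 2 = ENNReal.ofReal (∫ a, f a ^ 2 ∂μ) := by
  have h := eLpNorm_nnreal_pow_eq_lintegral (μ := μ) (f := f) (p := 2) (by norm_num)
  have h' : eLpNorm f 2 μ ^ 2 = ∫⁻ a, ‖f a‖ₑ ^ 2 ∂μ := by
    have e : ((2 : NNReal) : ℝ) = ((2 : ℕ) : ℝ) := by norm_num
    rw [e] at h
    simpa only [ENNReal.rpow_natCast, ENNReal.coe_ofNat] using h
  rw [h', ofReal_integral_eq_lintegral_ofReal hf.integrable_sq (ae_of_all _ fun a => sq_nonneg _)]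
  refine lintegral_congr fun a => ?_
  rw [← sq_abs, ENNReal.ofReal_pow (abs_nonneg _), Real.enorm_eq_ofReal_abs]

lemma eLpNorm_two_le_of_integral_sq_le {α β : Type*} [MeasurableSpace α] [MeasurableSpace β]
    {μ : Measure α} {ν : Measure β} {f : α → ℝ} {g : β → ℝ} (hf : MemLp f 2 μ) (hg : MemLp g 2 ν)
    {C : ℝ} (hC : 0 ≤ C) (h : ∫ a, f a ^ 2 ∂μ ≤ C * ∫ b, g b ^ 2 ∂ν) :
    eLpNorm f 2 μ ≤ ENNReal.ofReal √C * eLpNorm g 2 ν := by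
  rw [← ENNReal.pow_le_pow_left_iff (n := 2) two_ne_zero, mul_pow, eLpNorm_two_sq hf,
    eLpNorm_two_sq hg, ← ENNReal.ofReal_pow (Real.sqrt_nonneg _), Real.sq_sqrt hC,
    ← ENNReal.ofReal_mul hC]
  exact ENNReal.ofReal_le_ofReal h

/-- The joint distribution of independent uniform binary digits. -/
noncomputable abbrev digitLaw (s : ℕ) : Measure (Fin s × ℕ → Fin 2) :=
  Measure.infinitePi fun _ => fairDigit

section Variance

variable {Ω : Type*} [MeasurableSpace Ω] {Q : Measure Ω} {s : ℕ}
  {π : Ω → Fin s → List (Fin 2) → Equiv.Perm (Fin 2)}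

lemma memLp_walsh {ι α : Type*} [MeasurableSpace α] {μ : Measure α} [IsFiniteMeasure μ]
    {Y : α → ι → Fin 2} (hY : Measurable Y) (A : Finset ι) (p : ℝ≥0∞) :
    MemLp (fun a => walsh A (Y a)) p μ :=
  MemLp.of_bound ((measurable_walsh A).comp hY).aestronglyMeasurable 1
    (ae_of_all _ fun a => by rw [Real.norm_eq_abs, abs_walsh])

lemma IsNestedUniformScramble.integral_comp_scrambledDigits (hπ : IsNestedUniformScramble Q π)
    {f : (Fin s × ℕ → Fin 2) → ℝ} (hf : AEStronglyMeasurable f (digitLaw s)) (x : Fin s → ℝ) :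
    ∫ ω, f (scrambledDigits (π ω) x) ∂Q = ∫ c, f c ∂(digitLaw s) := by
  have h : Q.map (fun ω => scrambledDigits (π ω) x) = digitLaw s := hπ.map_scrambledDigits x
  rw [← h] at hf ⊢
  exact (integral_map (hπ.measurable_scrambledDigits x).aemeasurable hf).symm

lemma IsNestedUniformScramble.memLp_comp (hπ : IsNestedUniformScramble Q π)
    {f : (Fin s × ℕ → Fin 2) → ℝ} {p : ℝ≥0∞} (hf : MemLp f p (digitLaw s)) (x : Fin s → ℝ) :
    MemLp (fun ω => f (scrambledDigits (π ω) x)) p Q := by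
  have h : Q.map (fun ω => scrambledDigits (π ω) x) = digitLaw s := hπ.map_scrambledDigits x
  rw [← h] at hf
  exact hf.comp_of_map (hπ.measurable_scrambledDigits x).aemeasurable

lemma IsNestedUniformScramble.eLpNorm_comp (hπ : IsNestedUniformScramble Q π)
    {f : (Fin s × ℕ → Fin 2) → ℝ} {p : ℝ≥0∞} (hf : AEStronglyMeasurable f (digitLaw s))
    (x : Fin s → ℝ) :
    eLpNorm (fun ω => f (scrambledDigits (π ω) x)) p Q = eLpNorm f p (digitLaw s) := by
  have h : Q.map (fun ω => scrambledDigits (π ω) x) = digitLaw s := hπ.map_scrambledDigits x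
  rw [← h] at hf ⊢
  exact (eLpNorm_map_measure hf (hπ.measurable_scrambledDigits x).aemeasurable).symm

variable [IsProbabilityMeasure Q]

lemma gainKernel_self {x : Fin s → ℝ} (A : Finset (Fin s × ℕ)) : gainKernel A x x = 1 := by
  refine Finset.prod_eq_one fun j _ => ?_
  simp [sameCell]
  norm_num

lemma IsNestedUniformScramble.integral_walsh_mul_walsh_digitLaw
    (hπ : IsNestedUniformScramble Q π) (A B : Finset (Fin s × ℕ)) :
    ∫ c, walsh A c * walsh B c ∂(digitLaw s) = if A = B then 1 else 0 := by
  have h0 : ∀ j : Fin s, (0 : Fin s → ℝ) j ∈ Set.Ico (0 : ℝ) 1 := fun j => by simp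
  rw [← hπ.integral_comp_scrambledDigits (f := fun c => walsh A c * walsh B c)
    ((measurable_walsh A).mul (measurable_walsh B)).aestronglyMeasurable 0,
    hπ.integral_walsh_mul_walsh h0 h0, gainKernel_self]

lemma integral_sum_mul_sum {α κ κ' : Type*} [MeasurableSpace α] {μ : Measure α} [IsFiniteMeasure μ]
    (I : Finset κ) (I' : Finset κ') (f : κ → α → ℝ) (g : κ' → α → ℝ)
    (h : ∀ i j, Integrable (fun a => f i a * g j a) μ) :
    ∫ a, (∑ i ∈ I, f i a) * ∑ j ∈ I', g j a ∂μ = ∑ i ∈ I, ∑ j ∈ I', ∫ a, f i a * g j a ∂μ := by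
  simp only [Finset.sum_mul_sum]
  rw [integral_finsetSum _ fun i _ => integrable_finsetSum _ fun j _ => h i j]
  exact Finset.sum_congr rfl fun i _ => integral_finsetSum _ fun j _ => h i j

lemma IsNestedUniformScramble.integral_sq_walsh_sum (hπ : IsNestedUniformScramble Q π)
    (F : Finset (Finset (Fin s × ℕ))) (c : Finset (Fin s × ℕ) → ℝ) :
    ∫ z, (∑ A ∈ F, c A * walsh A z) ^ 2 ∂(digitLaw s) = ∑ A ∈ F, c A ^ 2 := by
  simp only [sq]
  rw [integral_sum_mul_sum]
  · refine Finset.sum_congr rfl fun A hA => ?_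
    have : ∀ B, ∫ z, c A * walsh A z * (c B * walsh B z) ∂(digitLaw s)
        = c A * c B * if A = B then 1 else 0 := by
      intro B
      rw [← hπ.integral_walsh_mul_walsh_digitLaw A B, ← integral_const_mul]
      exact integral_congr_ae (ae_of_all _ fun z => by ring)
    simp [this, hA]
  · intro A B
    exact ((memLp_walsh measurable_id A 2).const_mul _).integrable_mul
      ((memLp_walsh measurable_id B 2).const_mul _)

/-- The second moment of the sum of a centred Walsh polynomial over scrambled points. -/
lemma IsNestedUniformScramble.integral_sq_sum_walsh_sum_le (hπ : IsNestedUniformScramble Q π)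
    {y : ℕ → Fin s → ℝ} (hy : ∀ i j, y i j ∈ Set.Ico (0 : ℝ) 1) {n : ℕ} {C : ℝ}
    (hC : ∀ A : Finset (Fin s × ℕ), A.Nonempty →
      ∑ i ∈ Finset.range n, ∑ i' ∈ Finset.range n, gainKernel A (y i) (y i') ≤ C)
    {F : Finset (Finset (Fin s × ℕ))} (hF : ∅ ∉ F) (c : Finset (Fin s × ℕ) → ℝ) :
    ∫ ω, (∑ i ∈ Finset.range n, ∑ A ∈ F, c A * walsh A (scrambledDigits (π ω) (y i))) ^ 2 ∂Q
      ≤ C * ∑ A ∈ F, c A ^ 2 := by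
  have hL : ∀ i A, MemLp (fun ω => c A * walsh A (scrambledDigits (π ω) (y i))) 2 Q := fun i A =>
    (memLp_walsh (hπ.measurable_scrambledDigits _) A 2).const_mul _
  have hsum : ∀ i, MemLp (fun ω => ∑ A ∈ F, c A * walsh A (scrambledDigits (π ω) (y i))) 2 Q :=
    fun i => memLp_finsetSum _ fun A _ => hL i A
  have hpair : ∀ i i', ∫ ω, (∑ A ∈ F, c A * walsh A (scrambledDigits (π ω) (y i))) *
      ∑ B ∈ F, c B * walsh B (scrambledDigits (π ω) (y i')) ∂Q
      = ∑ A ∈ F, c A ^ 2 * gainKernel A (y i) (y i') := by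
    intro i i'
    rw [integral_sum_mul_sum _ _ _ _ fun A B => (hL i A).integrable_mul (hL i' B)]
    refine Finset.sum_congr rfl fun A hA => ?_
    have : ∀ B, ∫ ω, c A * walsh A (scrambledDigits (π ω) (y i)) *
        (c B * walsh B (scrambledDigits (π ω) (y i'))) ∂Q
        = c A * c B * if A = B then gainKernel A (y i) (y i') else 0 := by
      intro B
      rw [← hπ.integral_walsh_mul_walsh (hy i) (hy i') A B, ← integral_const_mul]
      exact integral_congr_ae (ae_of_all _ fun ω => by ring)
    simp [this, hA, sq]
  simp only [sq (∑ i ∈ Finset.range n, _)]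
  rw [integral_sum_mul_sum _ _ _ _ fun i i' => (hsum i).integrable_mul (hsum i')]
  simp only [hpair]
  rw [Finset.sum_congr rfl fun i _ => Finset.sum_comm, Finset.sum_comm, Finset.mul_sum]
  refine Finset.sum_le_sum fun A hA => ?_
  simp only [← Finset.mul_sum]
  rw [mul_comm]
  exact mul_le_mul_of_nonneg_right
    (hC A (Finset.nonempty_iff_ne_empty.2 fun h => hF (h ▸ hA))) (sq_nonneg _)

/-- The sum of the centred function `f - E f` over the scrambled points `y 0, …, y (n - 1)`. -/
noncomputable def centredSum (π : Ω → Fin s → List (Fin 2) → Equiv.Perm (Fin 2))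
    (y : ℕ → Fin s → ℝ) (n : ℕ) (f : (Fin s × ℕ → Fin 2) → ℝ) (ω : Ω) : ℝ :=
  ∑ i ∈ Finset.range n, (f (scrambledDigits (π ω) (y i)) - ∫ z, f z ∂(digitLaw s))

lemma IsNestedUniformScramble.memLp_centredSum (hπ : IsNestedUniformScramble Q π)
    (y : ℕ → Fin s → ℝ) (n : ℕ) {f : (Fin s × ℕ → Fin 2) → ℝ} (hf : MemLp f 2 (digitLaw s)) :
    MemLp (centredSum π y n f) 2 Q :=
  memLp_finsetSum _ fun i _ => (hπ.memLp_comp hf (y i)).sub (memLp_const _)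

/-- The bound of `centredSum` that ignores all cancellation. -/
lemma IsNestedUniformScramble.eLpNorm_centredSum_le_card (hπ : IsNestedUniformScramble Q π)
    (y : ℕ → Fin s → ℝ) (n : ℕ) {f : (Fin s × ℕ → Fin 2) → ℝ} (hf : MemLp f 2 (digitLaw s)) :
    eLpNorm (centredSum π y n f) 2 Q ≤ 2 * n * eLpNorm f 2 (digitLaw s) := by
  have hone : ∀ i, eLpNorm (fun ω => f (scrambledDigits (π ω) (y i)) - ∫ z, f z ∂(digitLaw s)) 2 Q
      ≤ 2 * eLpNorm f 2 (digitLaw s) := by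
    intro i
    refine (eLpNorm_sub_le (hπ.memLp_comp hf (y i)).1 aestronglyMeasurable_const
      (by norm_num)).trans ?_
    rw [hπ.eLpNorm_comp hf.1, two_mul]
    gcongr
    rw [eLpNorm_const _ (by norm_num) (IsProbabilityMeasure.ne_zero Q)]
    simp only [measure_univ, ENNReal.one_rpow, mul_one]
    refine (enorm_integral_le_lintegral_enorm _).trans ?_
    rw [← eLpNorm_one_eq_lintegral_enorm]
    exact eLpNorm_le_eLpNorm_of_exponent_le (by norm_num) hf.1
  have hsum : centredSum π y n f = ∑ i ∈ Finset.range n,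
      fun ω => f (scrambledDigits (π ω) (y i)) - ∫ z, f z ∂(digitLaw s) := by
    funext ω
    simp [centredSum]
  rw [hsum]
  refine (eLpNorm_sum_le (fun i _ => ((hπ.memLp_comp hf (y i)).sub (memLp_const _)).1)
    (by norm_num)).trans ?_
  refine (Finset.sum_le_card_nsmul _ _ _ fun i _ => hone i).trans (le_of_eq ?_)
  rw [Finset.card_range, nsmul_eq_mul]
  ring

lemma IsNestedUniformScramble.eLpNorm_centredSum_le_of_mem_walshSpan
    (hπ : IsNestedUniformScramble Q π) {y : ℕ → Fin s → ℝ}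
    (hy : ∀ i j, y i j ∈ Set.Ico (0 : ℝ) 1) {n : ℕ} {C : ℝ} (hC0 : 0 ≤ C)
    (hC : ∀ A : Finset (Fin s × ℕ), A.Nonempty →
      ∑ i ∈ Finset.range n, ∑ i' ∈ Finset.range n, gainKernel A (y i) (y i') ≤ C)
    {f : (Fin s × ℕ → Fin 2) → ℝ} (hf : f ∈ walshSpan (Fin s × ℕ)) :
    MemLp f 2 (digitLaw s) ∧
      eLpNorm (centredSum π y n f) 2 Q ≤ ENNReal.ofReal √C * eLpNorm f 2 (digitLaw s) := by
  classical
  obtain ⟨c, hc⟩ := (Finsupp.mem_span_range_iff_exists_finsupp).1 hf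
  have hfc : ∀ z, f z = ∑ A ∈ c.support, c A * walsh A z := by
    intro z
    rw [← hc]
    simp [Finsupp.sum]
  have hL : MemLp f 2 (digitLaw s) := by
    rw [show f = fun z => ∑ A ∈ c.support, c A * walsh A z from funext hfc]
    exact memLp_finsetSum _ fun A _ => (memLp_walsh measurable_id A 2).const_mul _
  refine ⟨hL, eLpNorm_two_le_of_integral_sq_le (hπ.memLp_centredSum y n hL) hL hC0 ?_⟩
  have hint : ∫ z, f z ∂(digitLaw s) = ∑ A ∈ c.support, if A = ∅ then c A else 0 := by
    simp only [hfc]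
    have hI : ∀ A, Integrable (fun z => c A * walsh A z) (digitLaw s) := fun A =>
      ((memLp_walsh measurable_id A 1).const_mul _).integrable le_rfl
    rw [integral_finsetSum _ fun A _ => hI A]
    refine Finset.sum_congr rfl fun A _ => ?_
    rw [integral_const_mul]
    have := hπ.integral_walsh_mul_walsh_digitLaw A ∅
    simp only [walsh, Finset.prod_empty, mul_one] at this
    unfold walsh
    rw [this]
    split_ifs <;> simp
  -- subtracting the mean removes the constant Walsh function
  have hcen : ∀ z, f z - ∫ z, f z ∂(digitLaw s) = ∑ A ∈ c.support.erase ∅, c A * walsh A z := by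
    intro z
    rw [hint, hfc, ← Finset.sum_sub_distrib]
    have h0 : ∀ A, c A * walsh A z - (if A = ∅ then c A else 0)
        = if A = ∅ then 0 else c A * walsh A z := by
      intro A
      split_ifs with h
      · simp [h, walsh]
      · simp
    simp only [h0]
    rw [Finset.sum_ite, Finset.sum_const_zero, zero_add]
    congr 1
    ext A
    simp [and_comm]
  simp only [centredSum, hcen]
  refine (hπ.integral_sq_sum_walsh_sum_le hy hC (Finset.notMem_erase _ _) _).trans ?_
  refine mul_le_mul_of_nonneg_left ?_ hC0
  simp only [hfc]
  rw [hπ.integral_sq_walsh_sum]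
  exact Finset.sum_le_sum_of_subset_of_nonneg (Finset.erase_subset _ _) fun _ _ _ => sq_nonneg _

/-- The variance bound of scrambled quadrature: the gain coefficients control the `L²` norm of the
centred sum of any square integrable function. -/
lemma IsNestedUniformScramble.eLpNorm_centredSum_le
    (hπ : IsNestedUniformScramble Q π) {y : ℕ → Fin s → ℝ}
    (hy : ∀ i j, y i j ∈ Set.Ico (0 : ℝ) 1) {n : ℕ} {C : ℝ} (hC0 : 0 ≤ C)
    (hC : ∀ A : Finset (Fin s × ℕ), A.Nonempty →
      ∑ i ∈ Finset.range n, ∑ i' ∈ Finset.range n, gainKernel A (y i) (y i') ≤ C)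
    {f : (Fin s × ℕ → Fin 2) → ℝ} (hf : MemLp f 2 (digitLaw s)) :
    eLpNorm (centredSum π y n f) 2 Q ≤ ENNReal.ofReal √C * eLpNorm f 2 (digitLaw s) := by
  set K := ENNReal.ofReal √C with hK
  set a := eLpNorm f 2 (digitLaw s) with ha
  have hbound : ∀ ε : ℝ, 0 < ε →
      eLpNorm (centredSum π y n f) 2 Q ≤ K * a + (K + 2 * n) * ENNReal.ofReal ε := by
    intro ε hε
    obtain ⟨p, hp, hfp⟩ := exists_walshSpan_eLpNorm_sub_le hf hε
    obtain ⟨hpL, hpn⟩ := hπ.eLpNorm_centredSum_le_of_mem_walshSpan hy hC0 hC hp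
    have hsplit : centredSum π y n f = centredSum π y n p + centredSum π y n (f - p) := by
      funext ω
      simp only [centredSum, Pi.add_apply, Pi.sub_apply, ← Finset.sum_add_distrib]
      refine Finset.sum_congr rfl fun i _ => ?_
      rw [integral_sub (hf.integrable (by norm_num)) (hpL.integrable (by norm_num))]
      ring
    have hpa : eLpNorm p 2 (digitLaw s) ≤ a + ENNReal.ofReal ε := by
      have : p = f - (f - p) := by abel
      rw [this]
      exact (eLpNorm_sub_le hf.1 (hf.1.sub hpL.1) (by norm_num)).trans (by gcongr)
    rw [hsplit]
    calc eLpNorm (centredSum π y n p + centredSum π y n (f - p)) 2 Q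
        ≤ eLpNorm (centredSum π y n p) 2 Q + eLpNorm (centredSum π y n (f - p)) 2 Q :=
          eLpNorm_add_le (hπ.memLp_centredSum y n hpL).1
            (hπ.memLp_centredSum y n (hf.sub hpL)).1 (by norm_num)
      _ ≤ K * (a + ENNReal.ofReal ε) + 2 * n * ENNReal.ofReal ε := by
          refine add_le_add (hpn.trans (by gcongr)) ?_
          exact (hπ.eLpNorm_centredSum_le_card y n (hf.sub hpL)).trans (by gcongr)
      _ = K * a + (K + 2 * n) * ENNReal.ofReal ε := by ring
  have hlim : Tendsto (fun ε : ℝ => K * a + (K + 2 * n) * ENNReal.ofReal ε) (𝓝[>] 0)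
      (𝓝 (K * a + (K + 2 * n) * ENNReal.ofReal 0)) := by
    refine tendsto_const_nhds.add (ENNReal.Tendsto.const_mul ?_ (Or.inr ?_))
    · exact (ENNReal.continuous_ofReal.tendsto 0).mono_left nhdsWithin_le_nhds
    · exact ENNReal.add_ne_top.2 ⟨ENNReal.ofReal_ne_top,
        ENNReal.mul_ne_top (by norm_num) (ENNReal.natCast_ne_top n)⟩
  have := ge_of_tendsto hlim (eventually_nhdsWithin_of_forall fun ε hε => hbound ε hε)
  simpa using this

end Variance

/-! ### The strong law of large numbers for scrambled points -/

lemma ae_tendsto_zero_of_lintegral_enorm_le {α : Type*} [MeasurableSpace α] {μ : Measure α}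
    {Z : ℕ → α → ℝ} (hZ : ∀ m, AEMeasurable (Z m) μ) {b : ℕ → ℝ} (hb0 : ∀ m, 0 ≤ b m)
    (hb : Summable b) (h : ∀ m, ∫⁻ a, ‖Z m a‖ₑ ∂μ ≤ ENNReal.ofReal (b m)) :
    ∀ᵐ a ∂μ, Tendsto (fun m => Z m a) atTop (𝓝 0) := by
  have hfin : ∫⁻ a, ∑' m, ‖Z m a‖ₑ ∂μ ≠ ∞ := by
    rw [lintegral_tsum fun m => (hZ m).enorm]
    refine ne_top_of_le_ne_top ?_ (ENNReal.tsum_le_tsum h)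
    rw [← ENNReal.ofReal_tsum_of_nonneg hb0 hb]
    exact ENNReal.ofReal_ne_top
  filter_upwards [ae_lt_top' (AEMeasurable.tsum fun m => (hZ m).enorm) hfin] with a ha
  have := ENNReal.tendsto_atTop_zero_of_tsum_ne_top ha.ne
  exact tendsto_zero_iff_enorm_tendsto_zero.2 this

lemma centredSum_mul {Ω : Type*} {s : ℕ} (π : Ω → Fin s → List (Fin 2) → Equiv.Perm (Fin 2))
    (x : ℕ → Fin s → ℝ) (n a : ℕ) (f : (Fin s × ℕ → Fin 2) → ℝ) :
    centredSum π x (n * a) f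
      = ∑ b ∈ Finset.range a, centredSum π (fun i => x (n * b + i)) n f := by
  induction a with
  | zero => funext ω; simp [centredSum]
  | succ a ih =>
    rw [Finset.sum_range_succ, ← ih]
    funext ω
    simp only [centredSum, Pi.add_apply, mul_add, mul_one, Finset.sum_range_add]

section StrongLaw

variable {Ω : Type*} [MeasurableSpace Ω] {Q : Measure Ω} [IsProbabilityMeasure Q] {s : ℕ}
  {π : Ω → Fin s → List (Fin 2) → Equiv.Perm (Fin 2)} {x : ℕ → Fin s → ℝ}

lemma IsNestedUniformScramble.ae_tendsto_centredSum (hπ : IsNestedUniformScramble Q π)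
    (hx : IsSobolSequence x) (hg : HasBoundedGain x) {f : (Fin s × ℕ → Fin 2) → ℝ}
    (hf : MemLp f 2 (digitLaw s)) (a : ℕ) :
    ∀ᵐ ω ∂Q, Tendsto (fun m : ℕ => ((2 : ℝ) ^ m)⁻¹ * centredSum π x (2 ^ m * a) f ω)
      atTop (𝓝 0) := by
  obtain ⟨Γ, hΓ0, hΓ⟩ := hx.exists_sum_gainKernel_le hg
  set N := (eLpNorm f 2 (digitLaw s)).toReal with hN
  have hN' : eLpNorm f 2 (digitLaw s) = ENNReal.ofReal N := (ENNReal.ofReal_toReal hf.2.ne).symm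
  have hnorm : ∀ m, eLpNorm (centredSum π x (2 ^ m * a) f) 2 Q
      ≤ ENNReal.ofReal (a * (√(2 ^ m * Γ) * N)) := by
    intro m
    rw [centredSum_mul]
    refine (eLpNorm_sum_le (fun b _ => (hπ.memLp_centredSum _ _ hf).1) (by norm_num)).trans ?_
    refine (Finset.sum_le_card_nsmul _ _ (ENNReal.ofReal √(2 ^ m * Γ) * ENNReal.ofReal N)
      fun b _ => ?_).trans (le_of_eq ?_)
    · rw [← hN']
      exact hπ.eLpNorm_centredSum_le (fun i j => hx.mem_Ico _ j) (by positivity)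
        (fun A hA => hΓ m b A hA) hf
    · rw [Finset.card_range, nsmul_eq_mul, ENNReal.ofReal_mul (Nat.cast_nonneg a),
        ENNReal.ofReal_mul (Real.sqrt_nonneg _), ENNReal.ofReal_natCast]
  have h2 : (1 : ℝ) < √2 := by
    rw [show (1 : ℝ) = √1 by simp]
    exact Real.sqrt_lt_sqrt (by norm_num) (by norm_num)
  refine ae_tendsto_zero_of_lintegral_enorm_le
    (fun m => (((hπ.memLp_centredSum x (2 ^ m * a) hf).1.aemeasurable).const_mul _))
    (b := fun m => (a * √Γ * N) * ((√2)⁻¹) ^ m) (fun m => by positivity)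
    ((summable_geometric_of_lt_one (by positivity) (inv_lt_one_of_one_lt₀ h2)).mul_left _)
    fun m => ?_
  simp only [enorm_mul]
  rw [lintegral_const_mul' _ _ enorm_ne_top, ← eLpNorm_one_eq_lintegral_enorm]
  refine (mul_le_mul_right ((eLpNorm_le_eLpNorm_of_exponent_le (p := 1) (q := 2) (by norm_num)
    (hπ.memLp_centredSum x (2 ^ m * a) hf).1).trans (hnorm m)) _).trans (le_of_eq ?_)
  rw [Real.enorm_eq_ofReal (by positivity), ← ENNReal.ofReal_mul (by positivity)]
  congr 1
  have ht : (0 : ℝ) < √2 ^ m := by positivity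
  have hsq : (2 : ℝ) ^ m = √2 ^ m * √2 ^ m := by rw [← mul_pow, Real.mul_self_sqrt (by norm_num)]
  rw [hsq, Real.sqrt_mul (by positivity), Real.sqrt_mul_self ht.le, inv_pow]
  field_simp

/-- If the averages of a monotone sequence converge along `a * 2 ^ m` for every `a > 0`, then they
converge. -/
lemma tendsto_div_of_tendsto_mul_two_pow {u : ℕ → ℝ} {l : ℝ} (hu : Monotone u)
    (h : ∀ a : ℕ, 0 < a →
      Tendsto (fun m : ℕ => u (2 ^ m * a) / ((2 ^ m * a : ℕ) : ℝ)) atTop (𝓝 l)) :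
    Tendsto (fun n => u n / n) atTop (𝓝 l) := by
  refine tendsto_div_of_monotone_of_exists_subseq_tendsto_div u l hu fun a ha => ?_
  -- `c` runs through the numbers with at most `r + 1` significant binary digits (from `2 ^ r` on);
  -- two consecutive ones have a ratio of at most `1 + 2 ^ (-r)`
  obtain ⟨r, hr⟩ : ∃ r : ℕ, 1 / (2 : ℝ) ^ r ≤ a - 1 := by
    obtain ⟨r, hr⟩ := exists_pow_lt_of_lt_one (sub_pos.2 ha) (show (1 / 2 : ℝ) < 1 by norm_num)
    exact ⟨r, by rw [← one_div_pow]; exact hr.le⟩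
  have hR : 0 < 2 ^ r := by positivity
  set c : ℕ → ℕ := fun n => 2 ^ (n / 2 ^ r) * (2 ^ r + n % 2 ^ r) with hc
  have hstep : ∀ n, c (n + 1) = c n + 2 ^ (n / 2 ^ r) := by
    intro n
    simp only [hc]
    by_cases hd : 2 ^ r ∣ n + 1
    · have h1 := Nat.succ_div_of_dvd hd
      have h2 : n % 2 ^ r + 1 = 2 ^ r := by
        have := Nat.add_mod n 1 (2 ^ r)
        have h3 := Nat.mod_lt n hR
        obtain ⟨k, hk⟩ := hd
        have h4 := Nat.div_add_mod n (2 ^ r)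
        have h5 : n / 2 ^ r + 1 = k := by
          rw [← h1]; simp [hk]
        subst h5
        rw [mul_add, mul_one] at hk
        omega
      have h3 : (n + 1) % 2 ^ r = 0 := Nat.mod_eq_zero_of_dvd hd
      rw [h3, show (n + 1) / 2 ^ r = n / 2 ^ r + 1 from h1, pow_succ]
      calc 2 ^ (n / 2 ^ r) * 2 * (2 ^ r + 0) = 2 ^ (n / 2 ^ r) * (2 ^ r + 2 ^ r) := by ring
        _ = 2 ^ (n / 2 ^ r) * (2 ^ r + (n % 2 ^ r + 1)) := by rw [h2]
        _ = 2 ^ (n / 2 ^ r) * (2 ^ r + n % 2 ^ r) + 2 ^ (n / 2 ^ r) := by ring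
    · have h1 := Nat.succ_div_of_not_dvd hd
      rw [show (n + 1) / 2 ^ r = n / 2 ^ r from h1]
      have h4 := Nat.div_add_mod n (2 ^ r)
      have h5 := Nat.div_add_mod (n + 1) (2 ^ r)
      rw [show (n + 1) / 2 ^ r = n / 2 ^ r from h1] at h5
      have : (n + 1) % 2 ^ r = n % 2 ^ r + 1 := by omega
      rw [this]; ring
  refine ⟨c, Eventually.of_forall fun n => ?_, ?_, ?_⟩
  · have h1 : (2 : ℝ) ^ (n / 2 ^ r) * 2 ^ r ≤ c n := by
      have : 2 ^ (n / 2 ^ r) * 2 ^ r ≤ c n := Nat.mul_le_mul_left _ (Nat.le_add_right _ _)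
      exact_mod_cast this
    have h2 : (2 : ℝ) ^ (n / 2 ^ r) ≤ (a - 1) * c n := by
      calc (2 : ℝ) ^ (n / 2 ^ r) = 1 / 2 ^ r * (2 ^ (n / 2 ^ r) * 2 ^ r) := by field_simp
        _ ≤ (a - 1) * c n := mul_le_mul hr h1 (by positivity) (by linarith)
    rw [hstep]
    push_cast
    linarith
  · refine (strictMono_nat_of_lt_succ fun n => ?_).tendsto_atTop
    rw [hstep]
    exact Nat.lt_add_of_pos_right (by positivity)
  · rw [Metric.tendsto_atTop]
    intro ε hε
    have hev : ∀ᶠ m in atTop, ∀ j ∈ Finset.range (2 ^ r),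
        dist (u (2 ^ m * (2 ^ r + j)) / ((2 ^ m * (2 ^ r + j) : ℕ) : ℝ)) l < ε :=
      (Finset.eventually_all _).2 fun j _ =>
        (h (2 ^ r + j) (by omega)).eventually (Metric.ball_mem_nhds l hε)
    obtain ⟨m₀, hm₀⟩ := eventually_atTop.1 hev
    refine ⟨2 ^ r * m₀, fun n hn => ?_⟩
    exact hm₀ (n / 2 ^ r) ((Nat.le_div_iff_mul_le hR).2 (by rwa [mul_comm])) (n % 2 ^ r)
      (Finset.mem_range.2 (Nat.mod_lt _ hR))

/-- The strong law for nonnegative square integrable functions. -/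
lemma IsNestedUniformScramble.strongLaw_nonneg (hπ : IsNestedUniformScramble Q π)
    (hx : IsSobolSequence x) (hg : HasBoundedGain x) {f : (Fin s → ℝ) → ℝ}
    (hf : MemLp f 2 (volume.restrict (Set.Icc 0 1))) (hf0 : ∀ v, 0 ≤ f v) :
    ∀ᵐ ω ∂Q, Tendsto (fun N : ℕ => (N : ℝ)⁻¹ * ∑ n ∈ Finset.range N, f (scramble (π ω) (x n)))
      atTop (𝓝 (∫ v in Set.Icc 0 1, f v)) := by
  have hlaw := map_ofDigitArray s
  have hF : MemLp (f ∘ ofDigitArray) 2 (digitLaw s) := by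
    rw [← hlaw] at hf
    exact hf.comp_of_map measurable_ofDigitArray.aemeasurable
  have hint : ∫ z, (f ∘ ofDigitArray) z ∂(digitLaw s) = ∫ v in Set.Icc 0 1, f v := by
    rw [← hlaw] at hf ⊢
    exact (integral_map measurable_ofDigitArray.aemeasurable hf.1).symm
  have hae : ∀ᵐ ω ∂Q, ∀ a : ℕ, Tendsto (fun m : ℕ =>
      ((2 : ℝ) ^ m)⁻¹ * centredSum π x (2 ^ m * a) (f ∘ ofDigitArray) ω) atTop (𝓝 0) :=
    ae_all_iff.2 fun a => hπ.ae_tendsto_centredSum hx hg hF a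
  filter_upwards [hae] with ω hω
  have hmono : Monotone fun N => ∑ n ∈ Finset.range N, f (scramble (π ω) (x n)) :=
    monotone_nat_of_le_succ fun n => by
      rw [Finset.sum_range_succ]
      exact le_add_of_nonneg_right (hf0 _)
  refine (tendsto_div_of_tendsto_mul_two_pow hmono fun a ha => ?_).congr fun n => by
    rw [div_eq_inv_mul]
  have h1 := ((hω a).const_mul ((a : ℝ)⁻¹)).add_const (∫ v in Set.Icc 0 1, f v)
  rw [mul_zero, zero_add] at h1
  refine h1.congr fun m => ?_
  have hsum : centredSum π x (2 ^ m * a) (f ∘ ofDigitArray) ω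
      = ∑ n ∈ Finset.range (2 ^ m * a), f (scramble (π ω) (x n))
        - ((2 ^ m * a : ℕ) : ℝ) * ∫ v in Set.Icc 0 1, f v := by
    unfold centredSum
    rw [Finset.sum_sub_distrib, Finset.sum_const, Finset.card_range, nsmul_eq_mul, hint]
    rfl
  have ha' : (a : ℝ) ≠ 0 := by exact_mod_cast ha.ne'
  rw [hsum]
  push_cast
  field_simp
  ring

/-- The strong law for square integrable functions with values in a Banach space. -/
theorem IsNestedUniformScramble.strongLaw (hπ : IsNestedUniformScramble Q π)
    (hx : IsSobolSequence x) (hg : HasBoundedGain x) {E : Type*} [NormedAddCommGroup E]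
    [NormedSpace ℝ E] [CompleteSpace E] {f : (Fin s → ℝ) → E}
    (hf : MemLp f 2 (volume.restrict (Set.Icc 0 1))) :
    ∀ᵐ ω ∂Q, Tendsto (fun N : ℕ => (N : ℝ)⁻¹ • ∑ n ∈ Finset.range N, f (scramble (π ω) (x n)))
      atTop (𝓝 (∫ v in Set.Icc 0 1, f v)) := by
  have : IsFiniteMeasure (volume.restrict (Set.Icc (0 : Fin s → ℝ) 1)) :=
    ⟨by simpa using isCompact_Icc.measure_lt_top⟩
  refine MemLp.induction (p := 2) (by norm_num) (fun f : (Fin s → ℝ) → E => ∀ᵐ ω ∂Q,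
    Tendsto (fun N : ℕ => (N : ℝ)⁻¹ • ∑ n ∈ Finset.range N, f (scramble (π ω) (x n)))
      atTop (𝓝 (∫ v in Set.Icc 0 1, f v))) ?_ ?_ ?_ ?_ hf
  · intro c t ht _
    have h1 : MemLp (t.indicator fun _ => (1 : ℝ)) 2 (volume.restrict (Set.Icc 0 1)) :=
      (memLp_const 1).indicator ht
    filter_upwards [hπ.strongLaw_nonneg hx hg h1 fun v => Set.indicator_nonneg (by simp) v]
      with ω hω
    have h2 := hω.smul_const c
    rw [integral_indicator_const _ ht, smul_eq_mul, mul_one, ← integral_indicator_const _ ht] at h2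
    refine h2.congr fun N => ?_
    rw [mul_smul, Finset.sum_smul]
    congr 1
    refine Finset.sum_congr rfl fun n _ => ?_
    simp only [Set.indicator]
    split_ifs <;> simp
  · intro f g _ hf hg hfω hgω
    filter_upwards [hfω, hgω] with ω h1 h2
    simp only [Pi.add_apply]
    rw [integral_add (hf.integrable (by norm_num)) (hg.integrable (by norm_num))]
    refine (h1.add h2).congr fun N => ?_
    rw [← smul_add, Finset.sum_add_distrib]
  · -- the averages of `‖f - g‖` converge to its integral, hence stay small if `g` is close to `f`
    refine isClosed_of_closure_subset fun f hfc => ?_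
    have hseq : ∀ k : ℕ, ∃ g : Lp E 2 (volume.restrict (Set.Icc (0 : Fin s → ℝ) 1)),
        (∀ᵐ ω ∂Q, Tendsto (fun N : ℕ => (N : ℝ)⁻¹ • ∑ n ∈ Finset.range N,
          g (scramble (π ω) (x n))) atTop (𝓝 (∫ v in Set.Icc 0 1, g v))) ∧
        ∫ v in Set.Icc 0 1, ‖f v - g v‖ ≤ 1 / ((k : ℝ) + 1) := by
      intro k
      obtain ⟨g, hg, hfg⟩ := Metric.mem_closure_iff.1 hfc (1 / ((k : ℝ) + 1)) (by positivity)
      refine ⟨g, hg, le_trans ?_ hfg.le⟩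
      have hL : MemLp (⇑f - ⇑g) 2 (volume.restrict (Set.Icc (0 : Fin s → ℝ) 1)) :=
        (Lp.memLp f).sub (Lp.memLp g)
      rw [Lp.dist_def, ← ENNReal.ofReal_le_ofReal_iff ENNReal.toReal_nonneg,
        ENNReal.ofReal_toReal hL.2.ne]
      have h1 : ENNReal.ofReal (∫ v in Set.Icc 0 1, ‖f v - g v‖)
          = eLpNorm (⇑f - ⇑g) 1 (volume.restrict (Set.Icc (0 : Fin s → ℝ) 1)) := by
        rw [eLpNorm_one_eq_lintegral_enorm]
        exact ofReal_integral_norm_eq_lintegral_enorm (hL.integrable (by norm_num))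
      rw [h1]
      have h2 := eLpNorm_le_eLpNorm_mul_rpow_measure_univ (p := 1) (q := 2) (by norm_num) hL.1
      have hvol : (volume.restrict (Set.Icc (0 : Fin s → ℝ) 1)) Set.univ = 1 := by
        simp [Real.volume_Icc_pi]
      simpa [hvol] using h2
    choose g hgω hgint using hseq
    have hdiff : ∀ k, MemLp (fun v => ‖f v - g k v‖) 2
        (volume.restrict (Set.Icc (0 : Fin s → ℝ) 1)) := fun k =>
      ((Lp.memLp f).sub (Lp.memLp (g k))).norm
    have hnω : ∀ᵐ ω ∂Q, ∀ k, Tendsto (fun N : ℕ => (N : ℝ)⁻¹ * ∑ n ∈ Finset.range N,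
        ‖f (scramble (π ω) (x n)) - g k (scramble (π ω) (x n))‖) atTop
        (𝓝 (∫ v in Set.Icc 0 1, ‖f v - g k v‖)) :=
      ae_all_iff.2 fun k => hπ.strongLaw_nonneg hx hg (hdiff k) fun v => norm_nonneg _
    change ∀ᵐ ω ∂Q, _
    filter_upwards [hnω, ae_all_iff.2 hgω] with ω h1 h2
    rw [Metric.tendsto_atTop']
    intro ε hε
    obtain ⟨k, hk⟩ := exists_nat_one_div_lt (show 0 < ε / 4 by positivity)
    have hint : ‖(∫ v in Set.Icc 0 1, g k v) - ∫ v in Set.Icc 0 1, f v‖ < ε / 4 := by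
      rw [← integral_sub ((Lp.memLp (g k)).integrable (by norm_num))
        ((Lp.memLp f).integrable (by norm_num))]
      refine (norm_integral_le_integral_norm _).trans_lt (lt_of_le_of_lt (le_of_eq ?_)
        ((hgint k).trans_lt hk))
      exact integral_congr_ae (ae_of_all _ fun v => norm_sub_rev _ _)
    have e1 := (h1 k).eventually (gt_mem_nhds (show _ < ε / 2 by linarith [hgint k]))
    have e2 := (Metric.tendsto_nhds.1 (h2 k)) (ε / 4) (by positivity)
    obtain ⟨N₀, hN₀⟩ := eventually_atTop.1 (e1.and e2)
    refine ⟨N₀, fun N hN => ?_⟩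
    obtain ⟨b1, b2⟩ := hN₀ N hN.le
    have b3 : dist ((N : ℝ)⁻¹ • ∑ n ∈ Finset.range N, f (scramble (π ω) (x n)))
        ((N : ℝ)⁻¹ • ∑ n ∈ Finset.range N, g k (scramble (π ω) (x n))) < ε / 2 := by
      refine lt_of_le_of_lt ?_ b1
      rw [dist_eq_norm, ← smul_sub, ← Finset.sum_sub_distrib, norm_smul, Real.norm_of_nonneg
        (by positivity)]
      exact mul_le_mul_of_nonneg_left (norm_sum_le _ _) (by positivity)
    rw [← dist_eq_norm] at hint
    linarith [dist_triangle4 ((N : ℝ)⁻¹ • ∑ n ∈ Finset.range N, f (scramble (π ω) (x n)))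
        ((N : ℝ)⁻¹ • ∑ n ∈ Finset.range N, g k (scramble (π ω) (x n)))
        (∫ v in Set.Icc 0 1, g k v) (∫ v in Set.Icc 0 1, f v)]
  · intro f g hfg _ hfω
    have hae : ∀ᵐ ω ∂Q, ∀ n, f (scramble (π ω) (x n)) = g (scramble (π ω) (x n)) := by
      refine ae_all_iff.2 fun n => ?_
      rw [← hπ.map_scramble (x n)] at hfg
      exact ae_of_ae_map (hπ.measurable_scramble (x n)).aemeasurable hfg
    filter_upwards [hfω, hae] with ω h1 h2
    rw [← integral_congr_ae hfg]
    exact h1.congr fun N => by simp only [h2]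

end StrongLaw

/-! ### The Fourier integrand and its integral -/

section Fourier

variable {Ω : Type*} [MeasurableSpace Ω] (P : Measure Ω) {k s : ℕ} (X : Ω → Fin k → ℝ)
  (ℓ : (Fin k → ℝ) → ℝ) (ν : ℕ) (K : Fin k → ℝ)

lemma fourierIntegrand_eq_exp_smul (m m₀ u : Fin k → ℝ) :
    fourierIntegrand P X ℓ ν K m u =
      Complex.exp (∑ j, ((K j : ℂ) - Complex.I * (u j : ℂ)) * ((m j : ℂ) - (m₀ j : ℂ))) •
        fourierIntegrand P X ℓ ν K m₀ u := by
  have h : Complex.exp (∑ j, ((K j : ℂ) - Complex.I * (u j : ℂ)) * (m j : ℂ)) =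
      Complex.exp (∑ j, ((K j : ℂ) - Complex.I * (u j : ℂ)) * ((m j : ℂ) - (m₀ j : ℂ))) *
        Complex.exp (∑ j, ((K j : ℂ) - Complex.I * (u j : ℂ)) * (m₀ j : ℂ)) := by
    rw [← Complex.exp_add, ← Finset.sum_add_distrib]
    congr 1
    exact Finset.sum_congr rfl fun j _ => by ring
  ext α
  simp only [fourierIntegrand, PiLp.smul_apply, smul_eq_mul, h]
  ring

lemma extCharFun_contour_neg (u : Fin k → ℝ) :
    extCharFun P X (contour (-u) K) = starRingEnd ℂ (extCharFun P X (contour u K)) := by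
  unfold extCharFun
  rw [← integral_conj]
  refine integral_congr_ae (ae_of_all _ fun ω => ?_)
  simp only [← Complex.exp_conj, contour, map_mul, map_sum, map_add, Complex.conj_I,
    Complex.conj_ofReal, Pi.neg_apply, Complex.ofReal_neg, Finset.mul_sum]
  congr 1
  exact Finset.sum_congr rfl fun j _ => by ring

lemma extFourier_contour_neg (f : (Fin k → ℝ) → ℝ) (u : Fin k → ℝ) :
    extFourier f (contour (-u) K) = starRingEnd ℂ (extFourier f (contour u K)) := by
  unfold extFourier
  rw [← integral_conj]
  refine integral_congr_ae (ae_of_all _ fun ω => ?_)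
  simp only [← Complex.exp_conj, contour, map_mul, map_neg, map_sum, map_add, Complex.conj_I,
    Complex.conj_ofReal, Pi.neg_apply, Complex.ofReal_neg, Finset.mul_sum]
  congr 2
  exact Finset.sum_congr rfl fun j _ => by ring

lemma fourierIntegrand_neg (m u : Fin k → ℝ) (α : Fin ν → Fin k) :
    fourierIntegrand P X ℓ ν K m (-u) α = starRingEnd ℂ (fourierIntegrand P X ℓ ν K m u α) := by
  simp only [fourierIntegrand, extCharFun_contour_neg, extFourier_contour_neg, map_mul, map_inv₀,
    map_pow, ← Complex.exp_conj, map_sum, map_sub, Complex.conj_I, Complex.conj_ofReal,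
    Pi.neg_apply, Complex.ofReal_neg, map_ofNat]
  congr 4
  exact Finset.sum_congr rfl fun j _ => by ring

/-- The Fourier integral is real, because the integrand at `-u` is conjugate to that at `u`. -/
lemma fourierIntegral_apply (m : Fin k → ℝ) (α : Fin ν → Fin k) :
    fourierIntegral P X ℓ ν K m α = ∫ u, fourierIntegrand P X ℓ ν K m u α := by
  have h : starRingEnd ℂ (∫ u, fourierIntegrand P X ℓ ν K m u α)
      = ∫ u, fourierIntegrand P X ℓ ν K m u α := by
    rw [← integral_conj]
    simp only [← fourierIntegrand_neg]
    exact integral_neg_eq_self (fun u => fourierIntegrand P X ℓ ν K m u α) volume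
  exact Complex.conj_eq_iff_re.1 h

variable {P X ℓ ν K}

lemma AdmissibleDamping.aestronglyMeasurable_fourierIntegrand (hK : AdmissibleDamping P X ℓ ν K)
    (m : Fin k → ℝ) (α : Fin ν → Fin k) :
    AEStronglyMeasurable (fun u => fourierIntegrand P X ℓ ν K m u α) volume := by
  have hc : Continuous fun u : Fin k → ℝ => ((2 * (Real.pi : ℂ)) ^ k)⁻¹ *
      Complex.exp (∑ j, ((K j : ℂ) - Complex.I * (u j : ℂ)) * (m j : ℂ)) := by fun_prop
  refine (hc.aestronglyMeasurable.mul (hK.integrable_prod α).1).congr (ae_of_all _ fun u => ?_)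
  simp only [fourierIntegrand, Pi.mul_apply]
  ring

/-! ### Domain transformations -/

lemma IsDomainTransform.aemeasurable {T : (Fin s → ℝ) → (Fin k → ℝ)} {J : (Fin s → ℝ) → ℝ}
    (hT : IsDomainTransform T J) : AEMeasurable T (volume.restrict (Set.Icc 0 1)) := by
  cases hT with
  | changeOfVariables T S hS hsub hfull hinj hdiff hsurj =>
    have hSI : S =ᵐ[volume] Set.Icc (0 : Fin k → ℝ) 1 :=
      (hsub.trans interior_subset).eventuallyLE.antisymm (ae_le_set.2 hfull)
    rw [← Measure.restrict_congr_set hSI]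
    have hc : ContinuousOn T S := fun v hv => (hdiff v hv).continuousAt.continuousWithinAt
    exact hc.aemeasurable hS
  | referenceDensity T ψ hTm _ _ _ => exact hTm

/-- A domain transformation moves integrals over `ℝ ^ k` to the unit cube. -/
lemma IsDomainTransform.integral_smul_comp {T : (Fin s → ℝ) → (Fin k → ℝ)} {J : (Fin s → ℝ) → ℝ}
    (hT : IsDomainTransform T J) {g : (Fin k → ℝ) → ℂ} (hg : AEStronglyMeasurable g volume) :
    ∫ v in Set.Icc 0 1, J v • g (T v) = ∫ u, g u := by
  cases hT with
  | changeOfVariables T S hS hsub hfull hinj hdiff hsurj =>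
    have hSI : S =ᵐ[volume] Set.Icc (0 : Fin k → ℝ) 1 :=
      (hsub.trans interior_subset).eventuallyLE.antisymm (ae_le_set.2 hfull)
    rw [← setIntegral_congr_set hSI, ← integral_image_eq_integral_abs_det_fderiv_smul volume hS
      (fun v hv => (hdiff v hv).hasFDerivAt.hasFDerivWithinAt) hinj g,
      setIntegral_congr_set (eventuallyEq_univ.2 (mem_ae_iff.2 hsurj)), setIntegral_univ]
  | referenceDensity T ψ hTm hψ hpos hlaw =>
    have hac : (volume.withDensity fun u => ENNReal.ofReal (ψ u)) ≪ volume :=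
      withDensity_absolutelyContinuous _ _
    have hm : AEStronglyMeasurable (fun u => (ψ u)⁻¹ • g u)
        (Measure.map T (volume.restrict (Set.Icc 0 1))) := by
      rw [hlaw]
      exact hψ.inv.aestronglyMeasurable.smul (hg.mono_ac hac)
    rw [← integral_map (f := fun u => (ψ u)⁻¹ • g u) hTm hm, hlaw,
      integral_withDensity_eq_integral_toReal_smul hψ.ennreal_ofReal
        (ae_of_all _ fun u => ENNReal.ofReal_lt_top)]
    refine integral_congr_ae ?_
    filter_upwards [hpos] with u hu
    rw [ENNReal.toReal_ofReal hu.le, smul_smul, mul_inv_cancel₀ hu.ne', one_smul]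

lemma integral_transformedIntegrand (hK : AdmissibleDamping P X ℓ ν K)
    {T : (Fin s → ℝ) → (Fin k → ℝ)} {J : (Fin s → ℝ) → ℝ} (hT : IsDomainTransform T J)
    {m : Fin k → ℝ}
    (hm : Integrable (transformedIntegrand P X ℓ ν K T J m) (volume.restrict (Set.Icc 0 1))) :
    ∫ v in Set.Icc 0 1, transformedIntegrand P X ℓ ν K T J m v = fourierIntegral P X ℓ ν K m := by
  ext α
  rw [fourierIntegral_apply, ← hT.integral_smul_comp
    (hK.aestronglyMeasurable_fourierIntegrand m α)]
  exact ((EuclideanSpace.proj (𝕜 := ℂ) α).integral_comp_comm hm).symm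

/-! ### The integrand as a function with values in a space of continuous functions -/

/-- The map `(u, e) ↦ (m ↦ exp ⟨K - i u, m - m₀⟩ • e)` into the continuous functions on `M`. -/
noncomputable def dampedExpMap (ν : ℕ) (K m₀ : Fin k → ℝ) (M : Set (Fin k → ℝ)) :
    C((Fin k → ℝ) × EuclideanSpace ℂ (Fin ν → Fin k),
      C(M, EuclideanSpace ℂ (Fin ν → Fin k))) :=
  ContinuousMap.curry
    ⟨fun q : ((Fin k → ℝ) × EuclideanSpace ℂ (Fin ν → Fin k)) × M =>
      Complex.exp (∑ j, ((K j : ℂ) - Complex.I * (q.1.1 j : ℂ)) *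
        (((q.2 : Fin k → ℝ) j : ℂ) - (m₀ j : ℂ))) • q.1.2, by
      have h : ∀ j, Continuous fun q : ((Fin k → ℝ) × EuclideanSpace ℂ (Fin ν → Fin k)) × M =>
          (q.2 : Fin k → ℝ) j :=
        fun j => (continuous_apply j).comp (continuous_subtype_val.comp continuous_snd)
      fun_prop⟩

lemma dampedExpMap_transformedIntegrand (T : (Fin s → ℝ) → (Fin k → ℝ)) (J : (Fin s → ℝ) → ℝ)
    (m₀ : Fin k → ℝ) (M : Set (Fin k → ℝ)) (m : M) (v : Fin s → ℝ) :
    dampedExpMap ν K m₀ M (T v, transformedIntegrand P X ℓ ν K T J m₀ v) m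
      = transformedIntegrand P X ℓ ν K T J m v := by
  simp only [dampedExpMap, ContinuousMap.curry_apply, ContinuousMap.coe_mk, transformedIntegrand]
  rw [fourierIntegrand_eq_exp_smul P X ℓ ν K m m₀, smul_comm]

lemma exists_norm_dampedExpMap_le (ν : ℕ) (K m₀ : Fin k → ℝ) (M : Set (Fin k → ℝ))
    [CompactSpace M] :
    ∃ c : ℝ, ∀ u e, ‖dampedExpMap ν K m₀ M (u, e)‖ ≤ c * ‖e‖ := by
  have hcont : Continuous fun m : M => Real.exp (∑ j, K j * ((m : Fin k → ℝ) j - m₀ j)) := by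
    have h : ∀ j, Continuous fun m : M => (m : Fin k → ℝ) j :=
      fun j => (continuous_apply j).comp continuous_subtype_val
    exact Real.continuous_exp.comp
      (continuous_finsetSum _ fun j _ => continuous_const.mul ((h j).sub continuous_const))
  obtain ⟨c, hc⟩ := isCompact_univ.exists_bound_of_continuousOn hcont.continuousOn
  refine ⟨max c 0, fun u e => (ContinuousMap.norm_le _ (by positivity)).2 fun m => ?_⟩
  simp only [dampedExpMap, ContinuousMap.curry_apply, ContinuousMap.coe_mk]
  rw [norm_smul, Complex.norm_exp]
  refine mul_le_mul_of_nonneg_right ((le_of_eq ?_).trans ((hc m (Set.mem_univ m)).trans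
    (le_max_left _ _))) (norm_nonneg _)
  rw [Real.norm_of_nonneg (Real.exp_pos _).le, Complex.re_sum]
  congr 1
  refine Finset.sum_congr rfl fun j _ => ?_
  simp [← Complex.ofReal_sub]

end Fourier

/-! ### Averages of replicates -/

lemma map_rqmcEstimator {s S : ℕ} {E F : Type*} [NormedAddCommGroup E] [NormedSpace ℝ E]
    [NormedAddCommGroup F] [NormedSpace ℝ F] (L : E →L[ℝ] F) (v : Fin S → ℕ → Fin s → ℝ) (N : ℕ)
    (f : (Fin s → ℝ) → E) :
    L (rqmcEstimator v N f) = rqmcEstimator v N fun x => L (f x) := by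
  simp only [rqmcEstimator, map_smul, map_sum]

lemma tendsto_rqmcEstimator {s S : ℕ} (hS : 0 < S) {E : Type*} [NormedAddCommGroup E]
    [NormedSpace ℝ E] {v : Fin S → ℕ → Fin s → ℝ} {f : (Fin s → ℝ) → E} {e : E}
    (h : ∀ r, Tendsto (fun N : ℕ => (N : ℝ)⁻¹ • ∑ n ∈ Finset.range N, f (v r n)) atTop (𝓝 e)) :
    Tendsto (fun N => rqmcEstimator v N f) atTop (𝓝 e) := by
  have h1 := (tendsto_finsetSum (Finset.univ : Finset (Fin S)) fun r _ => h r).const_smul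
    ((S : ℝ)⁻¹)
  rwa [Finset.sum_const, Finset.card_univ, Fintype.card_fin, ← Nat.cast_smul_eq_nsmul ℝ, smul_smul,
    inv_mul_cancel₀ (by exact_mod_cast hS.ne'), one_smul] at h1

end FourierRQMC

theorem lemma5p3
    {Ω : Type*} [MeasurableSpace Ω] (P : Measure Ω) [IsProbabilityMeasure P]
    {Ω' : Type*} [MeasurableSpace Ω'] (Q : Measure Ω') [IsProbabilityMeasure Q]
    {d k s S : ℕ}
    -- the loss vector, the selected coordinates, and the corresponding loss component
    (X : Ω → Fin d → ℝ) (hX : Measurable X)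
    (p : Fin k ↪o Fin d) (ℓ : (Fin k → ℝ) → ℝ)
    -- the compact set of allocations
    (M : Set (Fin d → ℝ)) (hM : IsCompact M)
    -- the derivative order and an admissible damping vector
    (ν : ℕ) (hν : ν ≤ 2) (K : Fin k → ℝ)
    (hK : FourierRQMC.AdmissibleDamping P (fun ω => FourierRQMC.proj p (X ω)) ℓ ν K)
    -- the domain transformation and the square integrability of the transformed integrands
    (T : (Fin s → ℝ) → (Fin k → ℝ)) (J : (Fin s → ℝ) → ℝ)
    (hT : FourierRQMC.IsDomainTransform T J)
    (hL2 : ∀ m ∈ FourierRQMC.proj p '' M,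
      MemLp (FourierRQMC.transformedIntegrand P (fun ω => FourierRQMC.proj p (X ω)) ℓ ν K T J m)
        2 (volume.restrict (Set.Icc 0 1)))
    -- the Sobol sequence
    (x : ℕ → Fin s → ℝ) (hx : FourierRQMC.IsSobolSequence x) (hgain : FourierRQMC.HasBoundedGain x)
    -- a fixed positive number of nested uniform scrambles
    (hS : 0 < S)
    (π : Fin S → Ω' → Fin s → List (Fin 2) → Equiv.Perm (Fin 2))
    (hπ : ∀ r, FourierRQMC.IsNestedUniformScramble Q (π r)) :
    ∀ᵐ ω ∂Q, Tendsto
      (fun N : ℕ => ⨆ m ∈ FourierRQMC.proj p '' M,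
        ‖FourierRQMC.rqmcEstimator (fun r n => FourierRQMC.scramble (π r ω) (x n)) N
            (FourierRQMC.transformedIntegrand P (fun ω' => FourierRQMC.proj p (X ω')) ℓ ν K T J m)
          - FourierRQMC.fourierIntegral P (fun ω' => FourierRQMC.proj p (X ω')) ℓ ν K m‖ₑ)
      atTop (𝓝 0) := by
  have hMk : IsCompact (FourierRQMC.proj p '' M) := by
    refine hM.image ?_
    unfold FourierRQMC.proj
    fun_prop
  rcases (FourierRQMC.proj p '' M).eq_empty_or_nonempty with hempty | ⟨m₀, hm₀⟩
  · simp [hempty]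
  generalize FourierRQMC.proj p '' M = A at *
  -- all parameters `m ∈ A` are treated at once: the integrand takes its values in `C(A, E)`, where
  -- the norm is the supremum over `m`
  have : CompactSpace A := isCompact_iff_compactSpace.1 hMk
  set F : (Fin s → ℝ) → C(A, EuclideanSpace ℂ (Fin ν → Fin k)) := fun v =>
    FourierRQMC.dampedExpMap ν K m₀ A (T v, FourierRQMC.transformedIntegrand P
      (fun ω => FourierRQMC.proj p (X ω)) ℓ ν K T J m₀ v) with hF
  have hFm : ∀ (m : A) v, F v m = FourierRQMC.transformedIntegrand P
      (fun ω => FourierRQMC.proj p (X ω)) ℓ ν K T J m v := fun m v =>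
    FourierRQMC.dampedExpMap_transformedIntegrand T J m₀ A m v
  have hFL : MemLp F 2 (volume.restrict (Set.Icc 0 1)) := by
    obtain ⟨c, hc⟩ := FourierRQMC.exists_norm_dampedExpMap_le ν K m₀ A
    refine MemLp.of_le_mul (c := c) (hL2 m₀ hm₀) ?_ (ae_of_all _ fun v => hc _ _)
    exact (FourierRQMC.dampedExpMap ν K m₀ A).continuous.comp_aestronglyMeasurable
      (hT.aemeasurable.aestronglyMeasurable.prodMk (hL2 m₀ hm₀).1)
  have hfin : IsFiniteMeasure (volume.restrict (Set.Icc (0 : Fin s → ℝ) 1)) :=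
    ⟨by simpa using isCompact_Icc.measure_lt_top⟩
  have hFint : Integrable F (volume.restrict (Set.Icc 0 1)) := hFL.integrable (by norm_num)
  have hlim : ∀ m : A, (∫ v in Set.Icc 0 1, F v) m
      = FourierRQMC.fourierIntegral P (fun ω' => FourierRQMC.proj p (X ω')) ℓ ν K m := by
    intro m
    rw [← FourierRQMC.integral_transformedIntegrand hK hT
      ((hL2 m m.2).integrable (by norm_num))]
    simp only [← hFm]
    exact ((ContinuousMap.evalCLM ℝ m).integral_comp_comm hFint).symm
  filter_upwards [ae_all_iff.2 fun r => (hπ r).strongLaw hx hgain hFL] with ω hω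
  have htend := FourierRQMC.tendsto_rqmcEstimator
    (v := fun r n => FourierRQMC.scramble (π r ω) (x n)) hS hω
  refine tendsto_of_tendsto_of_tendsto_of_le_of_le tendsto_const_nhds
    (tendsto_iff_enorm_sub_tendsto_zero.1 htend) (fun _ => zero_le) fun N => ?_
  refine iSup₂_le fun m hm => ?_
  have hest := FourierRQMC.map_rqmcEstimator (ContinuousMap.evalCLM ℝ (⟨m, hm⟩ : A))
    (fun r n => FourierRQMC.scramble (π r ω) (x n)) N F
  simp only [ContinuousMap.evalCLM_apply, hFm] at hest
  rw [← hest, ← hlim ⟨m, hm⟩, ← ContinuousMap.sub_apply, enorm_le_iff_norm_le]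
  exact ContinuousMap.norm_coe_le_norm _ _
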